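/- **Theorem 3 (maximal definability).** Let $\mathbb{YF}$ be the set of all finite words over the alphabet $\{1,2\}$ (including the empty word $\varepsilon$), ordered as follows: $y\geqslant x$ if, after deleting the longest common suffix of $x$ and $y$, the number of twos that remain in $y$ is at least the number of digits that remain in $x$ (the Young–Fibonacci lattice). Let $\langle\mathbb{YF},\geqslant,2\rangle$ be the first-order structure with this order and a constant for the one-letter word $2$. Let $p_0=2,\ p_1=3,\ p_2=5,\dots$ be the primes, let $d(v)$ be the number of twos in $v$, and define $b:\mathbb{YF}\to\mathbb N_0$ by $$b(v)=\begin{cases}0,& v=\varepsilon,\\ 2^{n-1},& v=1^n,\ n\geqslant 1,\\ p_{d(v)}^{\,e_{d(v)}+1}\cdot\prod_{i=0}^{d(v)-1}p_i^{\,e_i},& d(v)\geqslant 1,\ v=1^{e_0}21^{e_1}2\ldots 21^{e_{d(v)-1}}21^{e_{d(v)}}.\end{cases}$$ Then $b$ is a bijection, and the structure $\langle\mathbb{YF},\geqslant,2\rangle$ has the maximal definability property: for every $k\geqslant 0$, a relation $R\subseteq\mathbb{YF}^k$ is first-order definable (without parameters) in $\langle\mathbb{YF},\geqslant,2\rangle$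 if and only if it is arithmetical, i.e. if and only if the relation $\{(b(v_1),\dots,b(v_k)) : (v_1,\dots,v_k)\in R\}\subseteq\mathbb N_0^k$ is first-order definable (without parameters) in $\langle\mathbb N_0,+,\times\rangle$. -/

import Mathlib

/-- The alphabet `{1, 2}`. -/
inductive Digit : Type
  | one
  | two
  deriving DecidableEq

/-- Vertices of the Young–Fibonacci graph: words over `{1, 2}`, read from left to right. -/
abbrev YF : Type := List Digit

namespace YF

/-- `d v` is the number of twos in `v`. -/
def d (v : YF) : ℕ := v.count Digit.two

/-- The Young–Fibonacci order: `x` precedes `y` if, after deleting the longest common suffix `w`,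
at least as many twos remain in `y` as digits remain in `x`. -/
def Precedes (x y : YF) : Prop :=
  ∃ x' y' w : YF, x = x' ++ w ∧ y = y' ++ w ∧
    (∀ s : YF, s <:+ x → s <:+ y → s <:+ w) ∧ x'.length ≤ d y'

/-- If `v = 1^{e_0} 2 1^{e_1} 2 ⋯ 2 1^{e_{d(v)}}`, then `e v i = e_i` for `i ≤ d v`
(and `e v i = 0` for `i > d v`). -/
def e : YF → ℕ → ℕ
  | [], _ => 0
  | Digit.one :: v, 0 => e v 0 + 1
  | Digit.one :: v, i + 1 => e v (i + 1)
  | Digit.two :: _, 0 => 0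
  | Digit.two :: v, i + 1 => e v i

/-- The coding `b` of words by natural numbers; `Nat.nth Nat.Prime i` is the prime `p_i`,
with `p_0 = 2`. -/
noncomputable def b (v : YF) : ℕ :=
  if v = [] then 0
  else if d v = 0 then 2 ^ (v.length - 1)
  else Nat.nth Nat.Prime (d v) ^ (e v (d v) + 1) *
    ∏ i ∈ Finset.range (d v), Nat.nth Nat.Prime i ^ e v i

/-- Function symbols of the language of `⟨YF, ≥, 2⟩`: one constant. -/
inductive Func : ℕ → Type
  | two : Func 0

/-- Relation symbols of the language of `⟨YF, ≥, 2⟩`: one binary relation. -/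
inductive Rel : ℕ → Type
  | ge : Rel 2

/-- The first-order language `{≥, 2}`. -/
def lang : FirstOrder.Language := ⟨Func, Rel⟩

/-- The structure `⟨YF, ≥, 2⟩`. -/
instance instStructure : lang.Structure YF where
  funMap := fun f _ => match f with
    | Func.two => [Digit.two]
  RelMap := fun r x => match r with
    | Rel.ge => Precedes (x 1) (x 0)

end YF

namespace Arith

/-- Function symbols of the language `{+, ×}`. -/
inductive Func : ℕ → Type
  | add : Func 2
  | mul : Func 2

/-- The first-order language `{+, ×}`. -/
def lang : FirstOrder.Language := ⟨Func, fun _ => Empty⟩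

/-- The structure `⟨ℕ, +, ×⟩`. -/
instance instStructure : lang.Structure ℕ where
  funMap := fun f x => match f with
    | Func.add => x 0 + x 1
    | Func.mul => x 0 * x 1
  RelMap := fun r _ => r.elim

end Arith

/-- A relation on `YF` is arithmetical if the relation on `ℕ` that corresponds to it under the
coding `b` is first-order definable, without parameters, in `⟨ℕ, +, ×⟩`. -/
def YF.Arithmetical {k : ℕ} (R : Set (Fin k → YF)) : Prop :=
  (∅ : Set ℕ).Definable Arith.lang ((fun (v : Fin k → YF) (i : Fin k) => YF.b (v i)) '' R)

/-! Each structure is interpreted in the other, and the link between a word and its code is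
definable on both sides. `DefPred.pullback` moves definable relations along a surjection `f`,
provided that equality, operations and relations of the target, read through `f`, are definable in
the source.

From the lattice to arithmetic: on standard Gödel codes of words, the counts and block lengths are
primitive recursive, hence arithmetical by Gödel's β-function. So the order and the graph of `b` are
arithmetical, and the order can be carried over to codes under `b` (`arith_of_def`).

From arithmetic to the lattice: by `precedes_iff`, x ≤ y holds exactly when some common suffix c
satisfies |x| ≤ d(y) + o(c). This makes y = 1z and y = 2z recognizable from the order, the constant
separating 2 from 11. The crux is `one_cons_suffix_iff`, which expresses by the order alone that 1at
ends z; the whole suffix relation follows. A number n is represented by any word with n twos.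
Comparing powers of 1 with words 2^k 1^b gives addition, suffixes give the block lengths e_i, so
words serve as finite sequences, and multiplication is iterated addition. Hence all arithmetic of
the values of `d` is definable (`def_of_arith`). Finally b(v) = d(w) is definable (`def_b_eq_d`),
because a word is determined by its number of twos and its blocks, and both are arithmetical
functions of the code. Arithmetic then transfers along `b` itself (`def_of_arith_b`). -/

open FirstOrder FirstOrder.Language

-- Closure properties of definable predicates

universe u v

/-- A predicate on tuples is definable without parameters. -/
def DefPred (L : FirstOrder.Language.{u, v}) {M : Type*} [L.Structure M] {α : Type*}
    (P : (α → M) → Prop) : Prop :=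
  (∅ : Set M).Definable L {v | P v}

namespace DefPred

variable {L : FirstOrder.Language.{u, v}} {M : Type*} [L.Structure M] {α β : Type*}

theorem congr {P Q : (α → M) → Prop} (h : DefPred L P) (hPQ : ∀ v, Q v ↔ P v) : DefPred L Q := by
  have : Q = P := funext fun v => propext (hPQ v)
  rwa [this]

theorem and {P Q : (α → M) → Prop} (hP : DefPred L P) (hQ : DefPred L Q) :
    DefPred L fun v => P v ∧ Q v :=
  Set.Definable.inter hP hQ

theorem or {P Q : (α → M) → Prop} (hP : DefPred L P) (hQ : DefPred L Q) :
    DefPred L fun v => P v ∨ Q v :=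
  Set.Definable.union hP hQ

theorem not {P : (α → M) → Prop} (hP : DefPred L P) : DefPred L fun v => ¬ P v :=
  Set.Definable.compl hP

theorem imp {P Q : (α → M) → Prop} (hP : DefPred L P) (hQ : DefPred L Q) :
    DefPred L fun v => P v → Q v :=
  (hP.not.or hQ).congr fun _ => imp_iff_not_or

theorem false : DefPred L fun _ : α → M => False :=
  Set.definable_empty

theorem rename {P : (α → M) → Prop} (hP : DefPred L P) (f : α → β) :
    DefPred L fun v : β → M => P fun i => v (f i) :=
  Set.Definable.preimage_comp f hP

theorem ex_finite [Finite β] {P : (α → M) → (β → M) → Prop}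
    (hP : DefPred L fun v : α ⊕ β → M => P (fun i => v (Sum.inl i)) fun i => v (Sum.inr i)) :
    DefPred L fun v => ∃ u, P v u :=
  Set.Definable.exists_of_finite hP

theorem all_finite [Finite β] {P : (α → M) → (β → M) → Prop}
    (hP : DefPred L fun v : α ⊕ β → M => P (fun i => v (Sum.inl i)) fun i => v (Sum.inr i)) :
    DefPred L fun v => ∀ u, P v u :=
  Set.Definable.forall_of_finite hP

/-- A bound variable is the fresh index `none` of `Option α`; the free variables become `some i`. -/
theorem ex {P : (α → M) → M → Prop}
    (hP : DefPred L fun v : Option α → M => P (fun i => v (some i)) (v none)) :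
    DefPred L fun v => ∃ x, P v x := by
  have h : DefPred L fun v : α → M => ∃ u : Unit → M, P v (u ()) :=
    ex_finite (hP.rename fun i : Option α => i.elim (Sum.inr ()) Sum.inl)
  exact h.congr fun v => ⟨fun ⟨x, hx⟩ => ⟨fun _ => x, hx⟩, fun ⟨u, hu⟩ => ⟨u (), hu⟩⟩

theorem all {P : (α → M) → M → Prop}
    (hP : DefPred L fun v : Option α → M => P (fun i => v (some i)) (v none)) :
    DefPred L fun v => ∀ x, P v x := by
  have h : DefPred L fun v : α → M => ∀ u : Unit → M, P v (u ()) :=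
    all_finite (hP.rename fun i : Option α => i.elim (Sum.inr ()) Sum.inl)
  exact h.congr fun v => ⟨fun h u => h (u ()), fun h x => h fun _ => x⟩

theorem forall_index {ι : Type*} [Finite ι] {P : ι → (α → M) → Prop}
    (hP : ∀ i, DefPred L (P i)) : DefPred L fun v => ∀ i, P i v := by
  have h := Set.definable_iInter_of_finite (A := (∅ : Set M)) (L := L)
    (f := fun i => {v | P i v}) hP
  have e : (⋂ i, {v | P i v}) = {v | ∀ i, P i v} := by ext; simp
  rw [e] at h
  exact h

/-- Only the graph of `f` has to be definable: its value is named by a quantified variable, so no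
term for `f` is needed. -/
theorem subst {f : (α → M) → M} {Q : (α → M) → M → Prop}
    (hQ : DefPred L fun v : Option α → M => Q (fun i => v (some i)) (v none))
    (hf : DefPred L fun v : Option α → M => v none = f fun i => v (some i)) :
    DefPred L fun v => Q v (f v) := by
  have : DefPred L fun v : α → M => ∃ x, x = f v ∧ Q v x := .ex (.and hf hQ)
  exact this.congr fun v => by simp

theorem eq (i j : α) : DefPred L fun v : α → M => v i = v j :=
  Set.empty_definable_iff.2 ⟨(Term.var i).equal (Term.var j), by ext; simp⟩

theorem rel {n : ℕ} (R : L.Relations n) (i : Fin n → α) :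
    DefPred L fun v : α → M => Structure.RelMap R fun k => v (i k) :=
  Set.empty_definable_iff.2 ⟨R.formula fun k => Term.var (i k), by
    ext; simp [Formula.realize_rel]⟩

theorem funEq {n : ℕ} (F : L.Functions n) (j : α) (i : Fin n → α) :
    DefPred L fun v : α → M => v j = Structure.funMap F fun k => v (i k) :=
  Set.empty_definable_iff.2 ⟨(Term.var j).equal (Term.func F fun k => Term.var (i k)), by
    ext; simp⟩

end DefPred

/-! ### Transfer of definability along a surjection -/

section Transfer

variable {L L' : FirstOrder.Language.{u, v}} {M M' : Type*} [L.Structure M]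
  [L'.Structure M'] {f : M' → M}

/-- Surjectivity lets quantified preimages name the values of the subterms. Since `f` may identify
points, only f(x), never x itself, is compared with the value of a term. -/
theorem DefPred.term_pullback (hf : Function.Surjective f)
    (heq : DefPred L' fun v : Fin 2 → M' => f (v 0) = f (v 1))
    (hfun : ∀ (n : ℕ) (F : L.Functions n), DefPred L' fun v : Option (Fin n) → M' =>
      f (v none) = Structure.funMap F fun i => f (v (some i)))
    {α : Type*} (t : L.Term α) :
    DefPred L' fun v : Option α → M' => f (v none) = t.realize fun i => f (v (some i)) := by
  induction t with
  | var a => exact heq.rename ![none, some a]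
  | @func n F ts ih =>
    have h : DefPred L' fun v : Option α → M' => ∃ w : Fin n → M',
        (∀ i, f (w i) = (ts i).realize fun i => f (v (some i))) ∧
          f (v none) = Structure.funMap F fun i => f (w i) := by
      refine .ex_finite (.and (.forall_index fun i => ?_) ?_)
      · exact (ih i).rename fun j : Option α => j.elim (Sum.inr i) fun a => Sum.inl (some a)
      · exact (hfun n F).rename fun j : Option (Fin n) => j.elim (Sum.inl none) Sum.inr
    refine h.congr fun v => ⟨fun hv => ?_, fun ⟨w, hw, hv⟩ => ?_⟩
    · choose w hw using fun i => hf ((ts i).realize fun i => f (v (some i)))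
      exact ⟨w, hw, by simpa [hw] using hv⟩
    · simpa [hw] using hv

/-- Definable relations pull back to definable relations along a surjection along which equality,
the functions and the relations of the language do. -/
theorem DefPred.pullback (hf : Function.Surjective f)
    (heq : DefPred L' fun v : Fin 2 → M' => f (v 0) = f (v 1))
    (hfun : ∀ (n : ℕ) (F : L.Functions n), DefPred L' fun v : Option (Fin n) → M' =>
      f (v none) = Structure.funMap F fun i => f (v (some i)))
    (hrel : ∀ (n : ℕ) (R : L.Relations n), DefPred L' fun v : Fin n → M' =>
      Structure.RelMap R fun i => f (v i))
    {α : Type*} {P : (α → M) → Prop} (hP : DefPred L P) :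
    DefPred L' fun v : α → M' => P fun i => f (v i) := by
  obtain ⟨φ, hφ⟩ := Set.empty_definable_iff.1 hP
  have hterm := fun {β : Type _} (t : L.Term β) => DefPred.term_pullback hf heq hfun t
  have key : ∀ {n : ℕ} (φ : L.BoundedFormula α n), DefPred L' fun v : α ⊕ Fin n → M' =>
      φ.Realize (fun i => f (v (Sum.inl i))) fun i => f (v (Sum.inr i)) := by
    intro n φ
    induction φ with
    | falsum => exact .false
    | @equal n t₁ t₂ =>
      have h : DefPred L' fun v : α ⊕ Fin n → M' => ∃ x, f x = t₁.realize (fun i => f (v i)) ∧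
          f x = t₂.realize (fun i => f (v i)) := .ex (.and (hterm t₁) (hterm t₂))
      refine h.congr fun v => ?_
      have e : (Sum.elim (fun i => f (v (Sum.inl i))) fun i => f (v (Sum.inr i))) =
          fun i => f (v i) := by ext i; cases i <;> rfl
      simp only [BoundedFormula.Realize, e]
      refine ⟨fun h => ?_, fun ⟨x, h₁, h₂⟩ => h₁ ▸ h₂⟩
      obtain ⟨x, hx⟩ := hf (t₁.realize fun i => f (v i))
      exact ⟨x, hx, hx.trans h⟩
    | @rel n l R ts =>
      have h : DefPred L' fun v : α ⊕ Fin n → M' => ∃ w : Fin l → M',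
          (∀ i, f (w i) = (ts i).realize fun i => f (v i)) ∧
            Structure.RelMap R fun i => f (w i) := by
        refine .ex_finite (.and (.forall_index fun i => ?_) ?_)
        · exact (hterm (ts i)).rename fun j : Option (α ⊕ Fin n) => j.elim (Sum.inr i) Sum.inl
        · exact (hrel l R).rename Sum.inr
      refine h.congr fun v => ?_
      have e : (Sum.elim (fun i => f (v (Sum.inl i))) fun i => f (v (Sum.inr i))) =
          fun i => f (v i) := by ext i; cases i <;> rfl
      simp only [BoundedFormula.Realize, e]
      refine ⟨fun h => ?_, fun ⟨w, hw, h⟩ => ?_⟩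
      · choose w hw using fun i => hf ((ts i).realize fun i => f (v i))
        exact ⟨w, hw, by simpa [hw] using h⟩
      · simpa [hw] using h
    | imp _ _ ih₁ ih₂ => exact ih₁.imp ih₂
    | @all n φ ih =>
      have h : DefPred L' fun v : α ⊕ Fin n → M' => ∀ x : M', φ.Realize
          (fun i => f (v (Sum.inl i)))
          fun i => f (Fin.snoc (α := fun _ => M') (fun j => v (Sum.inr j)) x i) := by
        refine .all (α := α ⊕ Fin n) ((ih.rename (β := Option (α ⊕ Fin n)) fun i =>
          i.elim (fun a => some (Sum.inl a)) fun j =>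
            Fin.snoc (α := fun _ => Option (α ⊕ Fin n)) (fun k => some (Sum.inr k)) none j).congr
          fun v => ?_)
        refine iff_of_eq (congrArg _ (funext fun i => ?_))
        refine Fin.lastCases ?_ (fun i => ?_) i <;> simp
      refine h.congr fun v => ?_
      simp only [BoundedFormula.Realize]
      have e : ∀ x : M', (fun i => f (Fin.snoc (α := fun _ => M') (fun j => v (Sum.inr j)) x i)) =
          Fin.snoc (α := fun _ => M) (fun j => f (v (Sum.inr j))) (f x) := fun x => by
        ext i; refine Fin.lastCases ?_ (fun i => ?_) i <;> simp
      simp only [e]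
      exact ⟨fun h x => h (f x), fun h y => by obtain ⟨x, rfl⟩ := hf y; exact h x⟩
  have h := (key φ).rename (β := α) fun i : α ⊕ Fin 0 => i.elim id Fin.elim0
  refine h.congr fun v => ?_
  have : P (fun i => f (v i)) ↔ φ.Realize fun i => f (v i) := by
    have := Set.ext_iff.1 hφ fun i => f (v i)
    exact this
  rw [this, Formula.Realize]
  exact iff_of_eq (congrArg _ (funext fun i => i.elim0))

end Transfer

/-! ### Primitive recursive functions are arithmetical -/

/-- A function of tuples of numbers has an arithmetical graph. -/
def DefFn {α : Type*} (f : (α → ℕ) → ℕ) : Prop :=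
  DefPred Arith.lang fun v : Option α → ℕ => v none = f fun i => v (some i)

section ArithmeticDefinability

variable {α β : Type*} {f g h : (α → ℕ) → ℕ} {P : (α → ℕ) → Prop}

theorem DefFn.congr (hf : DefFn f) (e : ∀ v, g v = f v) : DefFn g :=
  funext e ▸ hf

theorem DefFn.rename (hf : DefFn f) (i : α → β) : DefFn fun v : β → ℕ => f fun j => v (i j) :=
  DefPred.rename hf (Option.map i)

theorem DefFn.var (i : α) : DefFn fun v : α → ℕ => v i :=
  DefPred.eq none (some i)

theorem DefPred.comp₂ {R : ℕ → ℕ → Prop}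
    (hR : DefPred Arith.lang fun v : Fin 2 → ℕ => R (v 0) (v 1))
    (hf : DefFn f) (hg : DefFn g) : DefPred Arith.lang fun v => R (f v) (g v) :=
  DefPred.subst (Q := fun v x => R x (g v)) (DefPred.subst (f := fun v => g fun i => v (some i))
    (Q := fun v x => R (v none) x) (hR.rename ![some none, none]) (hg.rename some)) hf

theorem DefPred.comp₃ {R : ℕ → ℕ → ℕ → Prop}
    (hR : DefPred Arith.lang fun v : Fin 3 → ℕ => R (v 0) (v 1) (v 2))
    (hf : DefFn f) (hg : DefFn g) (hh : DefFn h) :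
    DefPred Arith.lang fun v => R (f v) (g v) (h v) :=
  DefPred.subst (Q := fun v x => R x (g v) (h v))
    (DefPred.subst (f := fun v => g fun i => v (some i))
      (Q := fun v x => R (v none) x (h fun i => v (some i)))
      (DefPred.subst (f := fun v => h fun i => v (some (some i)))
        (Q := fun v x => R (v (some none)) (v none) x)
        (hR.rename ![some (some none), some none, none]) (hh.rename fun i => some (some i)))
      (hg.rename some)) hf

theorem DefFn.comp₁ {F : ℕ → ℕ} (hF : DefFn fun v : Fin 1 → ℕ => F (v 0)) (hf : DefFn f) :
    DefFn fun v => F (f v) :=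
  DefPred.comp₂ (R := fun y x => y = F x)
    (DefPred.rename hF fun i => i.elim (0 : Fin 2) fun _ => 1) (.var none) (hf.rename some)

theorem DefFn.comp₂ {F : ℕ → ℕ → ℕ} (hF : DefFn fun v : Fin 2 → ℕ => F (v 0) (v 1))
    (hf : DefFn f) (hg : DefFn g) : DefFn fun v => F (f v) (g v) :=
  DefPred.comp₃ (R := fun y x z => y = F x z)
    (DefPred.rename hF fun i => i.elim (0 : Fin 3) ![1, 2]) (.var none) (hf.rename some)
    (hg.rename some)

theorem DefFn.add (hf : DefFn f) (hg : DefFn g) : DefFn fun v => f v + g v :=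
  DefFn.comp₂ (F := fun x y => x + y)
    ((DefPred.funEq (L := Arith.lang) (M := ℕ) (n := 2) Arith.Func.add none some).congr
      fun _ => Iff.rfl) hf hg

theorem DefFn.mul (hf : DefFn f) (hg : DefFn g) : DefFn fun v => f v * g v :=
  DefFn.comp₂ (F := fun x y => x * y)
    ((DefPred.funEq (L := Arith.lang) (M := ℕ) (n := 2) Arith.Func.mul none some).congr
      fun _ => Iff.rfl) hf hg

theorem DefFn.eq (hf : DefFn f) (hg : DefFn g) : DefPred Arith.lang fun v => f v = g v :=
  DefPred.comp₂ (R := fun x y => x = y) (DefPred.eq 0 1) hf hg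

theorem DefFn.const (n : ℕ) : DefFn fun _ : α → ℕ => n := by
  -- The language has no constants: 0 is the only solution of x = x + x, and 1 the only nonzero
  -- solution of x = x * x.
  have zero : ∀ {α : Type _}, DefFn fun _ : α → ℕ => 0 := fun {α} =>
    ((((DefFn.var none).add (.var none)).eq (.var none)).congr fun v => by grind)
  have one : DefFn fun _ : α → ℕ => 1 :=
    (((((DefFn.var none).mul (.var none)).eq (.var none)).and
      ((DefFn.var none).eq zero).not).congr fun v => by
        refine ⟨fun h => by simp [h], fun h => ?_⟩
        have := h.1
        exact Nat.eq_of_mul_eq_mul_left (Nat.pos_of_ne_zero h.2) (by simpa using this))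
  induction n with
  | zero => exact zero
  | succ n ih => exact ih.add one

theorem DefFn.lt (hf : DefFn f) (hg : DefFn g) : DefPred Arith.lang fun v => f v < g v := by
  have : DefPred Arith.lang fun v : α → ℕ => ∃ x, g v = f v + x + 1 :=
    .ex (DefFn.eq (hg.rename some) (((hf.rename some).add (.var none)).add (.const 1)))
  exact this.congr fun v => ⟨fun h => ⟨g v - f v - 1, by omega⟩, fun ⟨x, h⟩ => by omega⟩

theorem DefFn.ite [∀ v, Decidable (P v)] (hP : DefPred Arith.lang P) (hf : DefFn f)
    (hg : DefFn g) : DefFn fun v => if P v then f v else g v :=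
  DefPred.congr (((hP.rename some).and hf).or ((hP.rename some).not.and hg)) fun v => by
    by_cases h : P fun i => v (some i) <;> simp [h]

theorem DefFn.mod (hf : DefFn f) (hg : DefFn g) : DefFn fun v => f v % g v := by
  have key : DefPred Arith.lang fun v : Option (Fin 2) → ℕ =>
      (v (some 1) = 0 ∧ v none = v (some 0)) ∨
        (v none < v (some 1) ∧ ∃ q, v (some 0) = v (some 1) * q + v none) :=
    .or (.and (DefFn.eq (.var _) (.const 0)) (.eq _ _))
      (.and (DefFn.lt (.var _) (.var _))
        (.ex (DefFn.eq (.var _) (((DefFn.var _).mul (.var _)).add (.var _)))))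
  refine DefFn.comp₂ (F := fun x y => x % y) (key.congr fun v => ?_) hf hg
  constructor
  · intro h
    rcases Nat.eq_zero_or_pos (v (some 1)) with h0 | h0
    · exact Or.inl ⟨h0, by simpa [h0] using h⟩
    · exact Or.inr ⟨h ▸ Nat.mod_lt _ h0, _, by rw [h]; exact (Nat.div_add_mod _ _).symm⟩
  · rintro (⟨h0, h⟩ | ⟨h, q, hq⟩)
    · simp [h0, h]
    · simp [hq, Nat.mod_eq_of_lt h]

theorem exists_beta_sequence (F : ℕ → ℕ) (n : ℕ) :
    ∃ a b, ∀ i ≤ n, a % ((i + 1) * b + 1) = F i := by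
  let l := (List.range (n + 1)).map F
  refine ⟨(Nat.unbeta l).unpair.1, (Nat.unbeta l).unpair.2, fun i hi => ?_⟩
  have hl : i < l.length := by simp [l]; omega
  have := Nat.beta_unbeta_coe l ⟨i, hl⟩
  simpa [Nat.beta, l] using this

/-- Functions with arithmetical graphs are closed under primitive recursion. -/
theorem DefFn.natRec {g : (α → ℕ) → ℕ → ℕ → ℕ} (hf : DefFn f)
    (hg : DefFn fun v : Option (Option α) → ℕ =>
      g (fun i => v (some (some i))) (v (some none)) (v none)) :
    DefFn fun v : Option α → ℕ =>
      Nat.rec (f fun i => v (some i)) (g fun i => v (some i)) (v none) := by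
  have hbeta {γ : Type _} {x y z : (γ → ℕ) → ℕ} (hx : DefFn x) (hy : DefFn y) (hz : DefFn z) :
      DefFn fun v => x v % ((z v + 1) * y v + 1) :=
    hx.mod (((hz.add (.const 1)).mul hy).add (.const 1))
  -- The numbers a and b code the sequence of values by the β-function. The variable r names the
  -- i-th value, so that `g` is applied to variables only.
  have key : DefPred Arith.lang fun v : Option (Option α) → ℕ => ∃ a b,
      a % ((0 + 1) * b + 1) = f (fun i => v (some (some i))) ∧
      (∀ i r, i < v (some none) → r = a % ((i + 1) * b + 1) →
        a % (((i + 1) + 1) * b + 1) = g (fun i => v (some (some i))) i r) ∧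
      v none = a % ((v (some none) + 1) * b + 1) := by
    refine .ex (.ex (.and ?_ (.and (.all (.all (.imp ?_ (.imp ?_ ?_)))) ?_)))
    · exact (hbeta (.var _) (.var _) (.const 0)).eq
        (hf.rename fun i => some (some (some (some i))))
    · exact (DefFn.var _).lt (.var _)
    · exact (DefFn.var _).eq (hbeta (.var _) (.var _) (.var _))
    · exact (hbeta (.var _) (.var _) ((DefFn.var _).add (.const 1))).eq
        (hg.rename fun i => i.elim none fun i => i.elim (some none)
          fun i => some (some (some (some (some (some i))))))
    · exact (DefFn.var _).eq (hbeta (.var _) (.var _) (.var _))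
  refine DefPred.congr key fun v => ?_
  let F : ℕ → ℕ := fun n =>
    Nat.rec (f fun i => v (some (some i))) (g fun i => v (some (some i))) n
  change v none = F (v (some none)) ↔ _
  generalize v (some none) = n
  constructor
  · intro h
    obtain ⟨a, b, hab⟩ := exists_beta_sequence F n
    refine ⟨a, b, hab 0 (Nat.zero_le _), fun i r hi hr => ?_, h.trans (hab n le_rfl).symm⟩
    rw [hab _ hi, hr, hab _ hi.le]
  · rintro ⟨a, b, h0, hs, h⟩
    have : ∀ i ≤ n, a % ((i + 1) * b + 1) = F i := by
      intro i
      induction i with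
      | zero => exact fun _ => h0
      | succ i ih => exact fun hi => (hs i _ hi rfl).trans (by rw [ih (Nat.le_of_succ_le hi)])
    exact h.trans (this n le_rfl)

theorem DefFn.pair (hf : DefFn f) (hg : DefFn g) : DefFn fun v => Nat.pair (f v) (g v) :=
  .ite (hf.lt hg) ((hg.mul hg).add hf) (((hf.mul hf).add hf).add hg)

theorem DefFn.unpair_fst (hf : DefFn f) : DefFn fun v => (f v).unpair.1 := by
  have key : DefPred Arith.lang fun v : Option (Fin 1) → ℕ =>
      ∃ b, Nat.pair (v none) b = v (some 0) := .ex (((DefFn.var _).pair (.var _)).eq (.var _))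
  refine DefFn.comp₁ (F := fun x => x.unpair.1) (key.congr fun v => ?_) hf
  change v none = (v (some 0)).unpair.1 ↔ _
  exact ⟨fun h => ⟨_, by rw [h, Nat.pair_unpair]⟩, fun ⟨b, hb⟩ => by rw [← hb]; simp⟩

theorem DefFn.unpair_snd (hf : DefFn f) : DefFn fun v => (f v).unpair.2 := by
  have key : DefPred Arith.lang fun v : Option (Fin 1) → ℕ =>
      ∃ b, Nat.pair b (v none) = v (some 0) := .ex (((DefFn.var _).pair (.var _)).eq (.var _))
  refine DefFn.comp₁ (F := fun x => x.unpair.2) (key.congr fun v => ?_) hf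
  change v none = (v (some 0)).unpair.2 ↔ _
  exact ⟨fun h => ⟨_, by rw [h, Nat.pair_unpair]⟩, fun ⟨b, hb⟩ => by rw [← hb]; simp⟩

theorem Nat.Primrec.defFn {F : ℕ → ℕ} (hF : Nat.Primrec F) {α : Type*} {f : (α → ℕ) → ℕ}
    (hf : DefFn f) : DefFn fun v => F (f v) := by
  have key : DefFn fun v : Fin 1 → ℕ => F (v 0) := by
    induction hF with
    | zero => exact .const 0
    | succ => exact (DefFn.var 0).add (.const 1)
    | left => exact (DefFn.var 0).unpair_fst
    | right => exact (DefFn.var 0).unpair_snd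
    | pair _ _ ih₁ ih₂ => exact ih₁.pair ih₂
    | comp _ _ ih₁ ih₂ => exact ih₁.comp₁ ih₂
    | @prec F G _ _ ih₁ ih₂ =>
      have h : DefFn fun v : Option (Fin 1) → ℕ => Nat.rec (F (v (some 0)))
          (fun y r => G (Nat.pair (v (some 0)) (Nat.pair y r))) (v none) :=
        DefFn.natRec (f := fun v : Fin 1 → ℕ => F (v 0))
          (g := fun v y r => G (Nat.pair (v 0) (Nat.pair y r))) ih₁
          (ih₂.comp₁ ((DefFn.var _).pair ((DefFn.var _).pair (.var _))))
      have h₂ : DefFn fun v : Fin 2 → ℕ => Nat.rec (F (v 0))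
          (fun y r => G (Nat.pair (v 0) (Nat.pair y r))) (v 1) :=
        h.rename fun i => i.elim (1 : Fin 2) fun _ => 0
      exact DefFn.comp₂ (F := fun a n => Nat.rec (F a)
          (fun y r => G (Nat.pair a (Nat.pair y r))) n)
        h₂ (DefFn.var (0 : Fin 1)).unpair_fst (DefFn.var 0).unpair_snd
  exact key.comp₁ hf

theorem Primrec.defFn {F : ℕ → ℕ} (hF : Primrec F) (hf : DefFn f) : DefFn fun v => F (f v) :=
  (Primrec.nat_iff.1 hF).defFn hf

theorem Primrec₂.defFn {F : ℕ → ℕ → ℕ} (hF : Primrec₂ F) (hf : DefFn f) (hg : DefFn g) :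
    DefFn fun v => F (f v) (g v) :=
  (Nat.Primrec.defFn (Primrec₂.unpaired'.2 hF) (hf.pair hg)).congr fun v => by simp

end ArithmeticDefinability

/-! ### The Young–Fibonacci order: covers, prefixing a digit, suffixes 1at -/

namespace YF

open Digit List

/-- The number of ones in a word. -/
def o (v : YF) : ℕ := v.count Digit.one

@[simp] theorem d_nil : d [] = 0 := rfl
@[simp] theorem o_nil : o [] = 0 := rfl
@[simp] theorem d_cons_one (v : YF) : d (one :: v) = d v := by simp [d]
@[simp] theorem d_cons_two (v : YF) : d (two :: v) = d v + 1 := by simp [d]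
@[simp] theorem o_cons_one (v : YF) : o (one :: v) = o v + 1 := by simp [o]
@[simp] theorem o_cons_two (v : YF) : o (two :: v) = o v := by simp [o]
@[simp] theorem d_append (v w : YF) : d (v ++ w) = d v + d w := by simp [d]
@[simp] theorem o_append (v w : YF) : o (v ++ w) = o v + o w := by simp [o]
@[simp] theorem d_replicate_one (n : ℕ) : d (replicate n one) = 0 := by simp [d, count_replicate]
@[simp] theorem d_replicate_two (n : ℕ) : d (replicate n two) = n := by simp [d]
@[simp] theorem o_replicate_one (n : ℕ) : o (replicate n one) = n := by simp [o]
@[simp] theorem o_replicate_two (n : ℕ) : o (replicate n two) = 0 := by simp [o, count_replicate]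

theorem length_eq (v : YF) : v.length = d v + o v := by
  induction v with
  | nil => rfl
  | cons a v ih => cases a <;> simp [ih] <;> omega

theorem o_le_of_suffix {v w : YF} (h : v <:+ w) : o v ≤ o w := h.sublist.count_le _
theorem d_le_of_suffix {v w : YF} (h : v <:+ w) : d v ≤ d w := h.sublist.count_le _

theorem eq_replicate_two {v : YF} (h : o v = 0) : v = replicate (d v) two := by
  induction v with
  | nil => rfl
  | cons a v ih =>
    cases a
    · simp at h
    · simpa [replicate_succ] using ih (by simpa using h)

theorem eq_replicate_one {v : YF} (h : d v = 0) : v = replicate (o v) one := by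
  induction v with
  | nil => rfl
  | cons a v ih =>
    cases a
    · simpa [replicate_succ] using ih (by simpa using h)
    · simp at h

theorem exists_cons_suffix {w c : YF} (h : w <:+ c) (hne : w ≠ c) : ∃ a, a :: w <:+ c := by
  obtain ⟨t, rfl⟩ := h
  obtain rfl | ⟨s, a, rfl⟩ := t.eq_nil_or_concat
  · simp at hne
  · exact ⟨a, s, by simp⟩

theorem cons_suffix_unique {a a' : Digit} {w z : YF} (h : a :: w <:+ z) (h' : a' :: w <:+ z) :
    a = a' := by
  have := (suffix_of_suffix_length_le h h' (by simp)).eq_of_length (by simp)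
  simpa using this

/-- A common suffix of two words that disagree just before a common suffix `w` lies inside `w`. -/
theorem suffix_of_diverge {a a' : Digit} {w x z c : YF} (ha : a ≠ a') (hx : a :: w <:+ x)
    (hz : a' :: w <:+ z) (hcx : c <:+ x) (hcz : c <:+ z) : c <:+ w := by
  rcases suffix_or_suffix_of_suffix hcx ((suffix_cons a w).trans hx) with h | h
  · exact h
  · by_cases e : w = c
    · exact e ▸ suffix_rfl
    · obtain ⟨b, hb⟩ := exists_cons_suffix h e
      exact absurd ((cons_suffix_unique hx (hb.trans hcx)).trans
        (cons_suffix_unique hz (hb.trans hcz)).symm) ha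

/-- For the longest common suffix w, |x'| ≤ d(y') amounts to |x| ≤ d(y) + o(w), since |w| = d(w) +
o(w). As o grows with the suffix, any common suffix may serve as a witness, and maximality
disappears. -/
theorem precedes_iff {x y : YF} :
    Precedes x y ↔ ∃ c, c <:+ x ∧ c <:+ y ∧ x.length ≤ d y + o c := by
  constructor
  · rintro ⟨x', y', w, rfl, rfl, -, h⟩
    refine ⟨w, suffix_append _ _, suffix_append _ _, ?_⟩
    simp [length_eq w]
    omega
  · rintro ⟨c, hx, hy, h⟩
    classical
    let P : ℕ → Prop := fun n => ∃ s, s <:+ x ∧ s <:+ y ∧ s.length = n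
    have hP : P (Nat.findGreatest P x.length) :=
      Nat.findGreatest_spec (P := P) (Nat.zero_le _) ⟨[], by simp⟩
    obtain ⟨w, hwx, hwy, hw⟩ := hP
    have hmax : ∀ s, s <:+ x → s <:+ y → s <:+ w := fun s hsx hsy =>
      suffix_of_suffix_length_le hsx hwx
        (hw ▸ Nat.le_findGreatest (P := P) hsx.length_le ⟨s, hsx, hsy, rfl⟩)
    obtain ⟨x', rfl⟩ := hwx
    obtain ⟨y', rfl⟩ := hwy
    refine ⟨x', y', w, rfl, rfl, hmax, ?_⟩
    have := o_le_of_suffix (hmax c hx hy)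
    simp [length_eq w] at h
    omega

theorem Precedes.of_suffix {x y : YF} (h : x <:+ y) : Precedes x y :=
  precedes_iff.2 ⟨x, suffix_rfl, h, by have := d_le_of_suffix h; rw [length_eq]; omega⟩

theorem Precedes.refl (x : YF) : Precedes x x := .of_suffix suffix_rfl

theorem Precedes.length_le {x y : YF} (h : Precedes x y) : x.length ≤ y.length := by
  obtain ⟨c, -, hy, h⟩ := precedes_iff.1 h
  have := o_le_of_suffix hy
  rw [length_eq y]
  omega

theorem Precedes.d_le {x y : YF} (h : Precedes x y) : d x ≤ d y := by
  obtain ⟨c, hx, -, h⟩ := precedes_iff.1 h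
  have := o_le_of_suffix hx
  rw [length_eq x] at h
  omega

/-- Both witnesses are suffixes of y, hence nested; the shorter one is common to x and z. -/
theorem Precedes.trans {x y z : YF} (hxy : Precedes x y) (hyz : Precedes y z) : Precedes x z := by
  have hd := hyz.d_le
  have hl := hxy.length_le
  obtain ⟨c, hcx, hcy, h⟩ := precedes_iff.1 hxy
  obtain ⟨c', hcy', hcz', h'⟩ := precedes_iff.1 hyz
  rcases suffix_or_suffix_of_suffix hcy hcy' with e | e
  · exact precedes_iff.2 ⟨c, hcx, e.trans hcz', by omega⟩
  · exact precedes_iff.2 ⟨c', e.trans hcx, hcz', by omega⟩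

theorem Precedes.antisymm {x y : YF} (hxy : Precedes x y) (hyx : Precedes y x) : x = y := by
  have hd := hyx.d_le
  have hl := hyx.length_le
  obtain ⟨c, ⟨x', rfl⟩, ⟨y', rfl⟩, h⟩ := precedes_iff.1 hxy
  have hl' := hxy.length_le
  have hd' := hxy.d_le
  simp only [length_eq, d_append, o_append] at *
  rw [eq_replicate_two (v := x') (by omega), eq_replicate_two (v := y') (by omega)]
  congr 2
  omega

theorem precedes_nil {x : YF} : Precedes x [] ↔ x = [] :=
  ⟨fun h => by simpa using h.length_le, fun h => h ▸ .refl _⟩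

theorem precedes_cons_one {x z : YF} :
    Precedes x (one :: z) ↔ x = one :: z ∨ Precedes x z := by
  constructor
  · intro h
    obtain ⟨c, hcx, hcz, h⟩ := precedes_iff.1 h
    rcases suffix_cons_iff.1 hcz with rfl | hcz
    · refine Or.inl (hcx.eq_of_length_le ?_).symm
      simp [length_eq z] at h ⊢
      omega
    · exact Or.inr (precedes_iff.2 ⟨c, hcx, hcz, by simpa using h⟩)
  · rintro (rfl | h)
    · exact .refl _
    · exact h.trans (.of_suffix (suffix_cons _ _))

theorem precedes_one_two (t : YF) : Precedes (one :: t) (two :: t) :=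
  precedes_iff.2 ⟨t, suffix_cons _ _, suffix_cons _ _, by simp [length_eq t]⟩

/-- A common suffix with z cannot reach the digit before w, so changing that digit leaves the
witness and the length intact. -/
theorem Precedes.swap {t w z : YF} (hw : ¬ one :: w <:+ z) (h : Precedes (t ++ one :: w) z) :
    Precedes (t ++ two :: w) z := by
  obtain ⟨c, hc, hcz, h⟩ := precedes_iff.1 h
  refine precedes_iff.2 ⟨c, ?_, hcz, by simpa using h⟩
  have e : one :: w <:+ t ++ one :: w := suffix_append _ _
  rcases suffix_or_suffix_of_suffix hc e with h | h
  · rcases suffix_cons_iff.1 h with rfl | h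
    · exact absurd hcz hw
    · exact h.trans ((suffix_cons _ _).trans (suffix_append _ _))
  · exact absurd (h.trans hcz) hw

/-- In other words, 2t covers 1t. -/
theorem eq_of_precedes_two {z t : YF} (h : Precedes (one :: t) z) (h' : Precedes z (two :: t)) :
    z = one :: t ∨ z = two :: t := by
  by_cases hs : one :: t <:+ z
  · left
    obtain ⟨c, hcz, hc, hl⟩ := precedes_iff.1 h'
    have := o_le_of_suffix (suffix_of_diverge (by simp) hs suffix_rfl hcz hc)
    refine (hs.eq_of_length_le ?_).symm
    simp [length_eq t] at hl ⊢
    omega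
  · exact Or.inr (h'.antisymm (Precedes.swap (t := []) hs h))

/-- The right side says that z is the greatest element strictly below y. This characterizes words
starting with 1, except that 2, like 11, has 1 as its greatest strict predecessor; the constant of
the language excludes that case. -/
theorem eq_cons_one_iff {y z : YF} : y = one :: z ↔
    y ≠ [two] ∧ Precedes z y ∧ z ≠ y ∧ ∀ x, Precedes x y → x ≠ y → Precedes x z := by
  constructor
  · rintro rfl
    exact ⟨by simp, .of_suffix (suffix_cons _ _), by simp, fun x hx hne =>
      (precedes_cons_one.1 hx).resolve_left hne⟩
  · rintro ⟨hy, hzy, hne, h⟩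
    match y with
    | [] => exact absurd (precedes_nil.1 hzy) hne
    | one :: t =>
      have h₁ := h t (.of_suffix (suffix_cons _ _)) (by simp)
      have h₂ := (precedes_cons_one.1 hzy).resolve_left hne
      rw [h₁.antisymm h₂]
    | two :: t =>
      exfalso
      have hz := (eq_of_precedes_two (h _ (precedes_one_two t) (by simp)) hzy).resolve_right hne
      subst hz
      -- Only 1t could be the greatest element strictly below 2t. For nonempty t this is refuted by
      -- an element below 2t but not below 1t: 2s if t = 1s, and 21s if t = 2s.
      match t with
      | [] => exact hy rfl
      | one :: s =>
        have hx := h (two :: s) (precedes_iff.2 ⟨s, suffix_cons _ _,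
          (suffix_cons _ _).trans (suffix_cons _ _), by simp [length_eq s]⟩) (by simp)
        have := hx.d_le
        simp at this
      | two :: s =>
        have hx := h (two :: one :: s) (precedes_iff.2 ⟨s, (suffix_cons _ _).trans (suffix_cons _ _),
          (suffix_cons _ _).trans (suffix_cons _ _), by simp [length_eq s]; omega⟩) (by simp)
        have := hx.antisymm (precedes_iff.2 ⟨s, (suffix_cons _ _).trans (suffix_cons _ _),
          (suffix_cons _ _).trans (suffix_cons _ _), ?_⟩)
        · simp at this
        · exfalso
          obtain ⟨c, hc, hc', hl⟩ := precedes_iff.1 hx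
          have := o_le_of_suffix (suffix_of_diverge (w := s) (a := one) (a' := two) (by simp)
            (suffix_cons _ _) (suffix_cons _ _) hc hc')
          simp [length_eq s] at hl
          omega

/-- 2z is the least element strictly above 1z and not above 11z. If such a u ends in 1z, the
preceding digit must be 2, and 2z ≤ 21z ≤ u; otherwise `Precedes.swap` applies. -/
theorem eq_cons_two_iff {y z : YF} : y = two :: z ↔
    (Precedes (one :: z) y ∧ one :: z ≠ y ∧ ¬ Precedes (one :: one :: z) y) ∧
    ∀ u, Precedes (one :: z) u → one :: z ≠ u → ¬ Precedes (one :: one :: z) u →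
      Precedes y u := by
  have h₁ : ¬ Precedes (one :: one :: z) (two :: z) := by
    intro h
    obtain ⟨c, hc, hc', hl⟩ := precedes_iff.1 h
    have := o_le_of_suffix (suffix_of_diverge (w := z) (a := one) (a' := two) (by simp)
      (suffix_cons _ _) suffix_rfl hc hc')
    simp [length_eq z] at hl
    omega
  have h₂ : ∀ u, Precedes (one :: z) u → one :: z ≠ u → ¬ Precedes (one :: one :: z) u →
      Precedes (two :: z) u := by
    intro u hu hne hn
    by_cases hs : one :: z <:+ u
    · obtain ⟨a, ha⟩ := exists_cons_suffix hs hne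
      cases a
      · exact absurd (.of_suffix ha) hn
      · refine .trans (precedes_iff.2 ⟨z, suffix_cons _ _, (suffix_cons _ _).trans (suffix_cons _ _),
          ?_⟩) (.of_suffix ha)
        simp [length_eq z]
    · exact Precedes.swap (t := []) hs hu
  constructor
  · rintro rfl
    exact ⟨⟨precedes_one_two z, by simp, h₁⟩, h₂⟩
  · rintro ⟨⟨h, hne, hn⟩, hmin⟩
    exact (hmin _ (precedes_one_two z) (by simp) h₁).antisymm (h₂ y h hne hn)

theorem exists_replicate_one_iff {x y : YF} : (∃ m, y = replicate m one ++ x) ↔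
    Precedes x y ∧ ∀ u, Precedes x u → x ≠ u → Precedes u y → ∃ t, u = one :: t := by
  constructor
  · rintro ⟨m, rfl⟩
    refine ⟨.of_suffix (suffix_append _ _), fun u hxu hne hu => ?_⟩
    induction m with
    | zero => exact absurd (hxu.antisymm hu) hne
    | succ m ih =>
      rcases precedes_cons_one.1 hu with rfl | hu
      · exact ⟨_, rfl⟩
      · exact ih hu
  · rintro ⟨hxy, h⟩
    induction y with
    | nil => exact ⟨0, (precedes_nil.1 hxy).symm⟩
    | cons a y ih =>
      by_cases e : x = a :: y
      · exact ⟨0, e.symm⟩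
      · obtain ⟨t, ht⟩ := h _ hxy e (.refl _)
        obtain ⟨rfl, rfl⟩ := List.cons.inj ht
        obtain ⟨m, rfl⟩ := ih ((precedes_cons_one.1 hxy).resolve_left e) fun u hu hne hu' =>
          h u hu hne (precedes_cons_one.2 (Or.inr hu'))
        exact ⟨m + 1, rfl⟩

/-- Write A = 1^m a t, B = 1^n 2 a t, C = 1^e a' t. By `Precedes.swap`, with n < m, only a word
ending in 1at can be above A but not above B. No comparison of exponents is available in the
language yet; the condition that every upper bound of A and C is above B forces n < m. -/
theorem one_cons_suffix_iff {a a' : Digit} (ha : a ≠ a') {t z : YF} :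
    one :: a :: t <:+ z ↔ ∃ m n e,
      (∀ y, Precedes (replicate m one ++ a :: t) y → Precedes (replicate e one ++ a' :: t) y →
        Precedes (replicate n one ++ two :: a :: t) y) ∧
      Precedes (replicate m one ++ a :: t) z ∧
      ¬ Precedes (replicate n one ++ two :: a :: t) z := by
  constructor
  · rintro ⟨z', rfl⟩
    refine ⟨d z' + 1, d z', d z' + 1, fun y hA hC => ?_, ?_, fun h => ?_⟩
    -- If y ends in 1at, then C and y diverge at t, so C ≤ y forces d(y) ≥ d(z') + 2 + d(t), enough
    -- for B ≤ y. Otherwise B arises from A by a swap.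
    · by_cases hs : one :: a :: t <:+ y
      · obtain ⟨c, hc, hcy, hl⟩ := precedes_iff.1 hC
        have := o_le_of_suffix (suffix_of_diverge (w := t) ha.symm (suffix_append _ _)
          ((suffix_cons _ _).trans hs) hc hcy)
        have := o_le_of_suffix (suffix_cons a t)
        refine precedes_iff.2 ⟨a :: t, (suffix_cons _ _).trans (suffix_append _ _),
          (suffix_cons _ _).trans hs, ?_⟩
        simp [length_eq t] at hl ⊢
        omega
      · refine Precedes.swap hs ?_
        simpa [replicate_succ'] using hA
    · refine precedes_iff.2 ⟨one :: a :: t, ?_, suffix_append _ _, ?_⟩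
      · rw [replicate_succ', append_assoc]
        exact suffix_append _ _
      · have := length_eq (a :: t)
        simp only [length_append, length_replicate, d_append, d_cons_one, o_cons_one]
        omega
    · obtain ⟨c, hc, hcz, hl⟩ := precedes_iff.1 h
      have := o_le_of_suffix (suffix_of_diverge (w := a :: t) (a := two) (a' := one) (by simp)
        (suffix_append _ _) (suffix_append _ _) hc hcz)
      have := length_eq (a :: t)
      simp only [length_append, length_replicate, d_append, d_cons_one, length_cons] at *
      omega
  · rintro ⟨m, n, e, hmn, hA, hB⟩
    have hlt : n < m := by
      by_contra hle
      -- This k is just large enough for A ≤ 2^k C. That word is also above C, but for m ≤ n it has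
      -- too few twos to be above B.
      obtain ⟨k, hk⟩ : ∃ k, k + d [a'] = m + 1 := by
        cases a'
        · exact ⟨m + 1, by simp⟩
        · exact ⟨m, by simp⟩
      have hd : d (a' :: t) = d [a'] + d t := d_append [a'] t
      have h := hmn (replicate k two ++ (replicate e one ++ a' :: t))
        (precedes_iff.2 ⟨t, (suffix_cons _ _).trans (suffix_append _ _),
          ((suffix_cons _ _).trans (suffix_append _ _)).trans (suffix_append _ _), by
            simp [length_eq t, hd]; omega⟩) (.of_suffix (suffix_append _ _))
      obtain ⟨c, hc, hcz, hl⟩ := precedes_iff.1 h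
      have := o_le_of_suffix (suffix_of_diverge (w := t) ha
        ((suffix_cons _ _).trans (suffix_append _ _))
        ((suffix_append _ _).trans (suffix_append _ _)) hc hcz)
      simp [length_eq t, hd] at hl
      omega
    by_contra hs
    -- Swapping the last one of the initial block of A yields a word below z that ends in B.
    obtain ⟨k, rfl⟩ := Nat.exists_eq_add_of_lt hlt
    refine hB (.trans (.of_suffix ?_) (Precedes.swap (t := replicate (n + k) one) hs
      (by simpa [replicate_succ'] using hA)))
    rw [Nat.add_comm n k, replicate_add, append_assoc]
    exact suffix_append _ _

end YF

/-! ### Order descriptions of runs, suffixes, arithmetic on `d`, and blocks -/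

namespace YF

open Digit List

theorem two_pow_precedes {k : ℕ} {y : YF} : Precedes (replicate k two) y ↔ k ≤ d y := by
  rw [precedes_iff]
  constructor
  · rintro ⟨c, hc, -, h⟩
    have := o_le_of_suffix hc
    simp at h this
    omega
  · exact fun h => ⟨[], by simp, by simp, by simpa using h⟩

theorem one_pow_precedes {m k b : ℕ} :
    Precedes (replicate m one) (replicate k two ++ replicate b one) ↔ m ≤ k + b := by
  rw [precedes_iff]
  constructor
  · rintro ⟨c, hc, hc', h⟩
    have : o c ≤ b := by simpa using o_le_of_suffix hc'
    simp at h
    omega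
  · intro h
    refine ⟨replicate (min m b) one, ?_, ?_, ?_⟩
    · exact ⟨replicate (m - min m b) one, by rw [← replicate_add]; congr 1; omega⟩
    · refine IsSuffix.trans ⟨replicate (b - min m b) one, ?_⟩ (suffix_append _ _)
      rw [← replicate_add]; congr 1; omega
    · simp; omega

theorem one_pow_precedes_two_pow {m k : ℕ} :
    Precedes (replicate m one) (replicate k two) ↔ m ≤ k := by
  simpa using one_pow_precedes (m := m) (k := k) (b := 0)

theorem one_pow_append_precedes {m k : ℕ} {u : YF} :
    Precedes (replicate m one ++ u) (replicate k two ++ u) ↔ m ≤ k := by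
  constructor
  · intro h
    rcases m with _ | m
    · omega
    rcases k with _ | k
    · simpa using h.length_le
    obtain ⟨c, hc, hc', hl⟩ := precedes_iff.1 h
    have := o_le_of_suffix (suffix_of_diverge (w := u) (a := one) (a' := two) (by simp)
      ⟨replicate m one, by simp [replicate_succ']⟩
      ⟨replicate k two, by simp [replicate_succ']⟩ hc hc')
    simp [length_eq u] at hl
    omega
  · intro h
    exact precedes_iff.2 ⟨u, suffix_append _ _, suffix_append _ _, by simp [length_eq u]; omega⟩

theorem exists_two_pow_or (w : YF) :
    (∃ j, w = replicate j two) ∨ ∃ j t, w = replicate j two ++ one :: t := by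
  induction w with
  | nil => exact .inl ⟨0, rfl⟩
  | cons a w ih =>
    cases a
    · exact .inr ⟨0, w, rfl⟩
    · rcases ih with ⟨j, rfl⟩ | ⟨j, t, rfl⟩
      · exact .inl ⟨j + 1, rfl⟩
      · exact .inr ⟨j + 1, t, rfl⟩

theorem exists_two_pow_or' (w : YF) :
    (∃ j, w = replicate j two) ∨ ∃ j t, w = t ++ one :: replicate j two := by
  induction w with
  | nil => exact .inl ⟨0, rfl⟩
  | cons a w ih =>
    rcases ih with ⟨j, rfl⟩ | ⟨j, t, rfl⟩
    · cases a
      · exact .inr ⟨j, [], rfl⟩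
      · exact .inl ⟨j + 1, rfl⟩
    · exact .inr ⟨j, a :: t, rfl⟩

theorem one_cons_suffix_two_pow {k : ℕ} {x u : YF} (h : one :: x <:+ replicate k two ++ u) :
    one :: x <:+ u := by
  induction k with
  | zero => exact h
  | succ k ih =>
    refine ih ((suffix_cons_iff.1 h).resolve_left ?_)
    simp

/-- Words of the form `2^k` or `2^k 1`. -/
def AlmostTwoPow (u : YF) : Prop := ∀ w, w ≠ [] → ¬ one :: w <:+ u

theorem almostTwoPow_iff {u : YF} :
    AlmostTwoPow u ↔ ∃ k, u = replicate k two ∨ u = replicate k two ++ [one] := by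
  constructor
  · intro h
    rcases exists_two_pow_or u with ⟨j, rfl⟩ | ⟨j, t, rfl⟩
    · exact ⟨j, .inl rfl⟩
    · by_cases ht : t = []
      · exact ⟨j, .inr (by rw [ht])⟩
      · exact absurd (suffix_append _ _) (h t ht)
  · rintro ⟨k, rfl | rfl⟩ w hw h
    · have := one_cons_suffix_two_pow (u := []) (by simpa using h)
      simp at this
    · have := (one_cons_suffix_two_pow h).length_le
      simp at this
      exact hw this

/-- The words 2^k and 2^k 1 form the chain ε < 1 < 2 < 21 < 22 < …. The largest power of 1 below 2^k
is 1^k, while 2^k 1 and 2^(k+1) share 1^(k+1). So a new power of 1 appears exactly on leaving a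
power of 2. -/
theorem exists_two_pow_iff {u : YF} : (∃ k, u = replicate k two) ↔
    AlmostTwoPow u ∧ ∃ a, (∃ m, a = replicate m one ++ []) ∧ ¬ Precedes a u ∧
      ∀ u', AlmostTwoPow u' → Precedes u u' → u ≠ u' → Precedes a u' := by
  have h₁ : ∀ m k, Precedes (replicate m one) (replicate k two ++ [one]) ↔ m ≤ k + 1 :=
    fun m k => one_pow_precedes (b := 1)
  constructor
  · rintro ⟨k, rfl⟩
    refine ⟨almostTwoPow_iff.2 ⟨k, .inl rfl⟩, _, ⟨k + 1, rfl⟩, ?_, fun u' hu' hle hne => ?_⟩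
    · simp [one_pow_precedes_two_pow]
    · rw [two_pow_precedes] at hle
      obtain ⟨j, rfl | rfl⟩ := almostTwoPow_iff.1 hu'
      · simp at hle
        rw [append_nil, one_pow_precedes_two_pow]
        exact lt_of_le_of_ne hle fun e => hne (by rw [e])
      · simp at hle
        rw [append_nil, h₁]
        omega
  · rintro ⟨hu, _, ⟨m, rfl⟩, hm, h⟩
    obtain ⟨k, rfl | rfl⟩ := almostTwoPow_iff.1 hu
    · exact ⟨k, rfl⟩
    · exfalso
      simp only [append_nil] at hm h
      have := h (replicate (k + 1) two) (almostTwoPow_iff.2 ⟨_, .inl rfl⟩)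
        (precedes_iff.2 ⟨[], by simp, by simp, by simp⟩) fun e => by simpa using congrArg o e
      rw [h₁] at hm
      rw [one_pow_precedes_two_pow] at this
      exact hm this

/-- The leftmost one of u is the one followed by the largest remainder. -/
theorem exists_two_pow_append_one_cons_iff {t u : YF} :
    (∃ k, u = replicate k two ++ one :: t) ↔
      one :: t <:+ u ∧ ∀ t', t' ≠ [] → one :: t' <:+ u → Precedes t' t := by
  constructor
  · rintro ⟨k, rfl⟩
    refine ⟨suffix_append _ _, fun t' _ h => ?_⟩
    rcases suffix_cons_iff.1 (one_cons_suffix_two_pow h) with h | h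
    · rw [(List.cons.inj h).2]
      exact .refl _
    · exact .of_suffix ((suffix_cons _ _).trans h)
  · rintro ⟨⟨q, rfl⟩, h⟩
    rcases exists_two_pow_or q with ⟨j, rfl⟩ | ⟨j, s, rfl⟩
    · exact ⟨j, rfl⟩
    · have := (h (s ++ one :: t) (by simp) (by simp)).length_le
      simp at this
      omega

/-- Both words must leave the same remainder once their leading twos are removed; then w ≤ u
compares the numbers of leading twos. Remainders ε and 1 are treated apart, because suffixes 1t are
at first definable only for nonempty t. -/
theorem exists_two_pow_append_iff {w u : YF} : (∃ k, u = replicate k two ++ w) ↔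
    Precedes w u ∧ (((∃ k, w = replicate k two) ∧ ∃ k, u = replicate k two) ∨
      ((AlmostTwoPow w ∧ ¬ ∃ k, w = replicate k two) ∧
        AlmostTwoPow u ∧ ¬ ∃ k, u = replicate k two) ∨
      ∃ t, t ≠ [] ∧ (∃ k, w = replicate k two ++ one :: t) ∧
        ∃ k, u = replicate k two ++ one :: t) := by
  have aux : ∀ {j k : ℕ} {t : YF}, Precedes (replicate j two ++ t) (replicate k two ++ t) →
      ∃ i, replicate k two ++ t = replicate i two ++ (replicate j two ++ t) := by
    intro j k t h
    have := h.length_le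
    simp at this
    exact ⟨k - j, by rw [← append_assoc, ← replicate_add]; congr 2; omega⟩
  constructor
  · rintro ⟨k, rfl⟩
    refine ⟨.of_suffix (suffix_append _ _), ?_⟩
    rcases exists_two_pow_or w with ⟨j, rfl⟩ | ⟨j, t, rfl⟩
    · exact .inl ⟨⟨j, rfl⟩, k + j, by rw [replicate_add]⟩
    · by_cases ht : t = []
      · subst ht
        refine .inr (.inl ⟨⟨almostTwoPow_iff.2 ⟨j, .inr rfl⟩, ?_⟩,
          almostTwoPow_iff.2 ⟨k + j, .inr (by rw [replicate_add, append_assoc])⟩, ?_⟩)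
        all_goals
          rintro ⟨i, h⟩
          simpa using congrArg o h
      · exact .inr (.inr ⟨t, ht, ⟨j, rfl⟩, k + j, by rw [replicate_add, append_assoc]⟩)
  · rintro ⟨h, ⟨⟨j, rfl⟩, k, rfl⟩ | ⟨⟨hw, hw'⟩, hu, hu'⟩ | ⟨t, -, ⟨j, rfl⟩, k, rfl⟩⟩
    · simpa using aux (t := []) (by simpa using h)
    · obtain ⟨j, rfl | rfl⟩ := almostTwoPow_iff.1 hw
      · exact absurd ⟨j, rfl⟩ hw'
      obtain ⟨k, rfl | rfl⟩ := almostTwoPow_iff.1 hu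
      · exact absurd ⟨k, rfl⟩ hu'
      exact aux h
    · exact aux h

/-- Extend x to the left through the twos that precede it in z: the extension ends at the start of z
or at a one. -/
theorem suffix_iff_exists {x z : YF} : x <:+ z ↔
    x = [] ∨ ∃ u, (∃ k, u = replicate k two ++ x) ∧ (u = z ∨ one :: u <:+ z) := by
  constructor
  · rintro ⟨q, rfl⟩
    refine .inr ?_
    rcases exists_two_pow_or' q with ⟨j, rfl⟩ | ⟨j, t, rfl⟩
    · exact ⟨_, ⟨j, rfl⟩, .inl rfl⟩
    · exact ⟨_, ⟨j, rfl⟩, .inr (by simp)⟩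
  · rintro (rfl | ⟨_, ⟨k, rfl⟩, rfl | h⟩)
    · simp
    · exact suffix_append _ _
    · exact (suffix_append _ _).trans ((suffix_cons _ _).trans h)

/-- 2^k ≤ x holds exactly when k ≤ d(x). -/
theorem d_le_iff {x y : YF} :
    d x ≤ d y ↔ ∀ u, (∃ k, u = replicate k two) → Precedes u x → Precedes u y := by
  constructor
  · rintro h _ ⟨k, rfl⟩ hk
    rw [two_pow_precedes] at *
    omega
  · intro h
    simpa [two_pow_precedes] using h _ ⟨d x, rfl⟩ (two_pow_precedes.2 le_rfl)

theorem eq_one_pow_d_iff {a x : YF} : a = replicate (d x) one ↔ (∃ m, a = replicate m one ++ []) ∧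
    ∃ u, (∃ k, u = replicate k two) ∧ d u = d x ∧ Precedes a u ∧ ¬ Precedes (one :: a) u := by
  constructor
  · rintro rfl
    refine ⟨⟨_, (append_nil _).symm⟩, _, ⟨d x, rfl⟩, by simp, ?_, ?_⟩
    · simp [one_pow_precedes_two_pow]
    · rw [← replicate_succ, one_pow_precedes_two_pow]
      omega
  · rintro ⟨⟨m, rfl⟩, _, ⟨k, rfl⟩, hk, h₁, h₂⟩
    simp only [append_nil, ← replicate_succ, one_pow_precedes_two_pow] at h₁ h₂
    simp at hk
    rw [append_nil]
    congr 1
    omega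

/-- The largest power of 1 below 2^k 1^b is 1^(k+b). -/
theorem d_add_eq_iff {x y z : YF} : d x + d y = d z ↔ ∃ a c u, a = replicate (d y) one ∧
    c = replicate (d z) one ∧ (∃ k, u = replicate k two ++ a) ∧ d u = d x ∧
      Precedes c u ∧ ¬ Precedes (one :: c) u := by
  constructor
  · intro h
    refine ⟨_, _, _, rfl, rfl, ⟨d x, rfl⟩, by simp, ?_, ?_⟩
    · rw [one_pow_precedes]; omega
    · rw [← replicate_succ, one_pow_precedes]; omega
  · rintro ⟨_, _, _, rfl, rfl, ⟨k, rfl⟩, hd, h₁, h₂⟩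
    rw [← replicate_succ] at h₂
    rw [one_pow_precedes] at h₁ h₂
    simp at hd
    omega

/-- The largest word 1^m u below 2^i u has m = i, and i is fixed by counting twos. -/
theorem eq_one_pow_append_iff {u r k : YF} : r = replicate (d k) one ++ u ↔
    (∃ m, r = replicate m one ++ u) ∧ ∃ y, (∃ i, y = replicate i two ++ u) ∧ d u + d k = d y ∧
      Precedes r y ∧ ¬ Precedes (one :: r) y := by
  constructor
  · rintro rfl
    refine ⟨⟨_, rfl⟩, _, ⟨d k, rfl⟩, by simp; omega, ?_, ?_⟩
    · rw [one_pow_append_precedes]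
    · rw [← cons_append, ← replicate_succ, one_pow_append_precedes]
      omega
  · rintro ⟨⟨m, rfl⟩, _, ⟨i, rfl⟩, hd, h₁, h₂⟩
    rw [← cons_append, ← replicate_succ] at h₂
    rw [one_pow_append_precedes] at h₁ h₂
    simp at hd
    congr 2
    omega

/-- A block `1^k` of a word, delimited by its ends or by twos. -/
theorem e_append {x u : YF} (hx : x = [] ∨ ∃ x', x = x' ++ [two]) (hu : ∀ t, u ≠ one :: t) (k : ℕ) :
    e (x ++ (replicate k one ++ u)) (d x) = k := by
  have h0 : e (replicate k one ++ u) 0 = k := by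
    induction k with
    | zero =>
      match u with
      | [] => rfl
      | one :: t => exact absurd rfl (hu t)
      | two :: t => rfl
    | succ k ih => simpa [replicate_succ, e] using ih
  rcases hx with rfl | ⟨x', rfl⟩
  · exact h0
  · induction x' with
    | nil => simpa [e] using h0
    | cons a x' ih =>
      cases a
      · simpa [e] using ih
      · simpa [e] using ih

theorem exists_block (v : YF) {i : ℕ} (hi : i ≤ d v) :
    ∃ x u, v = x ++ (replicate (e v i) one ++ u) ∧ d x = i ∧
      (x = [] ∨ ∃ x', x = x' ++ [two]) ∧ ∀ t, u ≠ one :: t := by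
  induction v generalizing i with
  | nil => exact ⟨[], [], by simp [e], by simp at hi; simp [hi], .inl rfl, by simp⟩
  | cons a v ih =>
    cases a
    · obtain ⟨x, u, hv, hx, hx', hu⟩ := ih (i := i) (by simpa using hi)
      rcases i with _ | i
      · have : x = [] := by
          rcases hx' with rfl | ⟨x', rfl⟩
          · rfl
          · simp at hx
        subst this
        exact ⟨[], u, by simpa [e, replicate_succ] using hv, rfl, .inl rfl, hu⟩
      · refine ⟨one :: x, u, by simpa [e] using hv, by simpa using hx, .inr ?_, hu⟩
        rcases hx' with rfl | ⟨x', rfl⟩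
        · simp at hx
        · exact ⟨one :: x', rfl⟩
    · rcases i with _ | i
      · exact ⟨[], two :: v, by simp [e], rfl, .inl rfl, by simp⟩
      · obtain ⟨x, u, hv, hx, hx', hu⟩ := ih (i := i) (by simpa using hi)
        refine ⟨two :: x, u, by simpa [e] using hv, by simpa using hx, .inr ?_, hu⟩
        rcases hx' with rfl | ⟨x', rfl⟩
        · exact ⟨[], rfl⟩
        · exact ⟨two :: x', rfl⟩

theorem e_eq_zero {v : YF} {i : ℕ} (hi : d v < i) : e v i = 0 := by
  induction v generalizing i with
  | nil => rfl
  | cons a v ih =>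
    rcases i with _ | i
    · omega
    cases a
    · exact ih (by simpa using hi)
    · exact ih (by simpa using hi)

/-- The word u is what follows block number d(i): its count of twos locates it, and it does not
start with 1. The block length is the largest number of ones that can be put before u within v. The
first disjunct is the default value 0 beyond the last block. -/
theorem e_eq_d_iff {v i k : YF} : e v (d i) = d k ↔
    (¬ d i ≤ d v ∧ d k ≤ d ([] : YF)) ∨ ∃ u, (¬ ∃ t, u = one :: t) ∧ u <:+ v ∧ d u + d i = d v ∧
      ∃ r, r = replicate (d k) one ++ u ∧ r <:+ v ∧ ¬ one :: r <:+ v := by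
  have key : ∀ {v u : YF} {i k : ℕ}, (¬ ∃ t, u = one :: t) → d u + i = d v →
      replicate k one ++ u <:+ v → ¬ one :: (replicate k one ++ u) <:+ v → e v i = k := by
    rintro v u i k hu hd ⟨x, rfl⟩ hn
    have : x = [] ∨ ∃ x', x = x' ++ [two] := by
      obtain rfl | ⟨x', a, rfl⟩ := x.eq_nil_or_concat
      · exact .inl rfl
      · cases a
        · exact absurd (by simp) hn
        · exact .inr ⟨x', by simp⟩
    have h := e_append this (fun t ht => hu ⟨t, ht⟩) k
    have hi : i = d x := by simp at hd; omega
    rw [hi, h]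
  constructor
  · intro h
    by_cases hi : d i ≤ d v
    · right
      obtain ⟨x, u, hv, hx, hx', hu⟩ := exists_block v hi
      rw [h] at hv
      refine ⟨u, fun ⟨t, ht⟩ => hu t ht, hv ▸ (suffix_append _ _).trans (suffix_append _ _), ?_,
        _, rfl, hv ▸ suffix_append _ _, fun hs => ?_⟩
      · rw [hv]; simp; omega
      · rw [hv] at hs
        rcases hx' with rfl | ⟨x', rfl⟩
        · simpa using hs.length_le
        · exact absurd (cons_suffix_unique hs (by simp : two :: _ <:+ _)) (by simp)
    · exact .inl ⟨hi, by rw [← h, e_eq_zero (not_le.1 hi)]; exact Nat.zero_le _⟩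
  · rintro (⟨hi, hk⟩ | ⟨u, hu, -, hd, _, rfl, h₁, h₂⟩)
    · rw [e_eq_zero (not_le.1 hi)]; simp at hk; exact hk.symm
    · exact key hu hd h₁ h₂

/-- Words thus code all nonempty finite sequences, with no β-function on this side. -/
theorem exists_word (n : ℕ) (g : ℕ → ℕ) : ∃ v, d v = n ∧ ∀ i ≤ n, e v i = g i := by
  have hone : ∀ (k : ℕ) (w : YF) (i : ℕ), e (replicate k one ++ w) i =
      if i = 0 then k + e w 0 else e w i := by
    intro k w i
    induction k with
    | zero => split_ifs with h <;> simp [h]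
    | succ k ih =>
      rcases i with _ | i
      · simp [replicate_succ, e] at ih ⊢; omega
      · simpa [replicate_succ, e] using ih
  induction n generalizing g with
  | zero =>
    refine ⟨replicate (g 0) one ++ [], by simp, fun i hi => ?_⟩
    obtain rfl : i = 0 := by omega
    simpa [e] using hone (g 0) [] 0
  | succ n ih =>
    obtain ⟨v, hv, h⟩ := ih fun i => g (i + 1)
    refine ⟨replicate (g 0) one ++ two :: v, by simp [hv], fun i hi => ?_⟩
    rcases i with _ | i
    · simp [hone, e]
    · simpa [hone, e] using h i (by omega)

theorem eq_of_e_eq {v w : YF} (hd : d v = d w) (he : ∀ i ≤ d v, e v i = e w i) : v = w := by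
  induction v generalizing w with
  | nil =>
    match w with
    | [] => rfl
    | one :: w => simpa [e] using he 0 (by simp)
    | two :: w => simp at hd
  | cons a v ih =>
    cases a
    · match w with
      | [] => simpa [e] using he 0 (by simp)
      | one :: w =>
        rw [ih (by simpa using hd) fun i hi => ?_]
        rcases i with _ | i
        · simpa [e] using he 0 (by simp)
        · simpa [e] using he (i + 1) (by simpa using hi)
      | two :: w => simpa [e] using he 0 (by simp)
    · match w with
      | [] => simp at hd
      | one :: w => simpa [e] using he 0 (by simp)
      | two :: w =>
        rw [ih (by simpa using hd) fun i hi => ?_]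
        simpa [e] using he (i + 1) (by simpa using hi)

/-- The word v records the multiples 0, d(x), 2·d(x), …, d(y)·d(x) as its blocks; each comes from
the previous one by an addition. -/
theorem d_mul_eq_iff {x y z : YF} : d x * d y = d z ↔ ∃ v, d v = d y ∧
    e v (d ([] : YF)) = d ([] : YF) ∧ (∀ i j, ¬ d v ≤ d i → d i + d [two] = d j →
      ∃ k l, e v (d i) = d k ∧ e v (d j) = d l ∧ d k + d x = d l) ∧ e v (d y) = d z := by
  constructor
  · intro h
    obtain ⟨v, hv, he⟩ := exists_word (d y) fun i => d x * i
    refine ⟨v, hv, by simpa using he 0 (by simp), fun i j hi hj => ?_, by rw [he _ le_rfl, h]⟩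
    have hj' : d j = d i + 1 := by simpa using hj.symm
    refine ⟨replicate (d x * d i) two, replicate (d x * d j) two, ?_, ?_, ?_⟩
    · rw [he _ (by omega)]; simp
    · rw [he _ (by omega)]; simp
    · simp [hj']; ring
  · rintro ⟨v, hv, h0, hs, hz⟩
    have : ∀ i ≤ d y, e v i = d x * i := by
      intro i
      induction i with
      | zero => exact fun _ => by simpa using h0
      | succ i ih =>
        intro hi
        obtain ⟨k, l, hk, hl, hkl⟩ := hs (replicate i two) (replicate (i + 1) two)
          (by simp; omega) (by simp)
        simp only [d_replicate_two] at hk hl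
        rw [ih (by omega)] at hk
        rw [hl, ← hkl, ← hk]
        ring
    rw [← hz, this _ le_rfl]

end YF

/-! ### First-order definability in the lattice -/

namespace YF

open Digit List

section Definability

variable {α : Type*}

theorem def_le (i j : α) : DefPred lang fun v : α → YF => Precedes (v i) (v j) :=
  (DefPred.rel (L := lang) (M := YF) (n := 2) Rel.ge ![j, i]).congr fun _ => Iff.rfl

theorem def_nil (i : α) : DefPred lang fun v : α → YF => v i = [] := by
  have h : DefPred lang fun v : α → YF => ∀ x, Precedes (v i) x := .all (def_le _ _)
  exact h.congr fun v => ⟨fun h x => h ▸ .of_suffix (nil_suffix), fun h => precedes_nil.1 (h [])⟩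

theorem def_const_two (i : α) : DefPred lang fun v : α → YF => v i = [two] :=
  (DefPred.funEq (L := lang) (M := YF) (n := 0) Func.two i Fin.elim0).congr fun _ => Iff.rfl

theorem def_cons_one (i j : α) : DefPred lang fun v : α → YF => v i = one :: v j := by
  have h : DefPred lang fun v : α → YF => v i ≠ [two] ∧ Precedes (v j) (v i) ∧ v j ≠ v i ∧
      ∀ x, Precedes x (v i) → x ≠ v i → Precedes x (v j) :=
    .and (.not (def_const_two _)) (.and (def_le _ _) (.and (.not (.eq _ _))
      (.all (.imp (def_le _ _) (.imp (.not (.eq _ _)) (def_le _ _))))))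
  exact h.congr fun v => eq_cons_one_iff

theorem def_cons_one_le (i j : α) :
    DefPred lang fun v : α → YF => Precedes (one :: v i) (v j) :=
  .subst (f := fun v => one :: v i) (Q := fun v x => Precedes x (v j)) (def_le _ _)
    (def_cons_one _ _)

theorem def_cons_two (i j : α) : DefPred lang fun v : α → YF => v i = two :: v j := by
  have h : DefPred lang fun v : α → YF => ∃ w, w = one :: v j ∧
      (Precedes w (v i) ∧ w ≠ v i ∧ ¬ Precedes (one :: w) (v i)) ∧
      ∀ u, Precedes w u → w ≠ u → ¬ Precedes (one :: w) u → Precedes (v i) u :=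
    .ex (.and (def_cons_one _ _) (.and (.and (def_le _ _) (.and (.not (.eq _ _))
      (.not (def_cons_one_le _ _)))) (.all (.imp (def_le _ _) (.imp (.not (.eq _ _))
        (.imp (.not (def_cons_one_le _ _)) (def_le _ _)))))))
  exact h.congr fun v => by rw [eq_cons_two_iff]; simp

theorem def_cons (a : Digit) (i j : α) : DefPred lang fun v : α → YF => v i = a :: v j := by
  cases a
  · exact def_cons_one i j
  · exact def_cons_two i j

theorem def_one_chain (i j : α) :
    DefPred lang fun v : α → YF => ∃ m, v i = replicate m one ++ v j := by
  have h : DefPred lang fun v : α → YF => Precedes (v j) (v i) ∧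
      ∀ u, Precedes (v j) u → v j ≠ u → Precedes u (v i) → ∃ t, u = one :: t :=
    .and (def_le _ _) (.all (.imp (def_le _ _) (.imp (.not (.eq _ _)) (.imp (def_le _ _)
      (.ex (def_cons_one _ _))))))
  exact h.congr fun v => exists_replicate_one_iff

theorem def_one_cons_cons_suffix (a : Digit) (i j : α) :
    DefPred lang fun v : α → YF => one :: a :: v i <:+ v j := by
  obtain ⟨a', ha⟩ : ∃ a', a ≠ a' := by
    cases a
    · exact ⟨two, by simp⟩
    · exact ⟨one, by simp⟩
  have h : DefPred lang fun v : α → YF => ∃ w w' w₂, w = a :: v i ∧ w' = a' :: v i ∧ w₂ = two :: w ∧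
      ∃ A B C, (∃ m, A = replicate m one ++ w) ∧ (∃ n, B = replicate n one ++ w₂) ∧
        (∃ e, C = replicate e one ++ w') ∧ (∀ y, Precedes A y → Precedes C y → Precedes B y) ∧
        Precedes A (v j) ∧ ¬ Precedes B (v j) :=
    .ex (.ex (.ex (.and (def_cons _ _ _) (.and (def_cons _ _ _) (.and (def_cons _ _ _)
      (.ex (.ex (.ex (.and (def_one_chain _ _) (.and (def_one_chain _ _) (.and (def_one_chain _ _)
        (.and (.all (.imp (def_le _ _) (.imp (def_le _ _) (def_le _ _))))
          (.and (def_le _ _) (.not (def_le _ _)))))))))))))))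
  refine h.congr fun v => ?_
  rw [one_cons_suffix_iff ha]
  constructor
  · rintro ⟨m, n, e, h⟩
    exact ⟨_, _, _, rfl, rfl, rfl, _, _, _, ⟨m, rfl⟩, ⟨n, rfl⟩, ⟨e, rfl⟩, h⟩
  · rintro ⟨_, _, _, rfl, rfl, rfl, _, _, _, ⟨m, rfl⟩, ⟨n, rfl⟩, ⟨e, rfl⟩, h⟩
    exact ⟨m, n, e, h⟩

/-- `one_cons_suffix_iff` needs a digit after the one, whence the nonemptiness;
`def_one_cons_suffix'` drops it once suffixes are definable. -/
theorem def_one_cons_suffix (i j : α) :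
    DefPred lang fun v : α → YF => v i ≠ [] ∧ one :: v i <:+ v j := by
  have h : DefPred lang fun v : α → YF => ∃ t, (v i = one :: t ∧ one :: one :: t <:+ v j) ∨
      (v i = two :: t ∧ one :: two :: t <:+ v j) :=
    .ex (.or (.and (def_cons_one _ _) (def_one_cons_cons_suffix _ _ _))
      (.and (def_cons_two _ _) (def_one_cons_cons_suffix _ _ _)))
  refine h.congr fun v => ⟨fun ⟨hn, hs⟩ => ?_, ?_⟩
  · match v i, hn, hs with
    | one :: t, _, hs => exact ⟨t, .inl ⟨rfl, hs⟩⟩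
    | two :: t, _, hs => exact ⟨t, .inr ⟨rfl, hs⟩⟩
  · rintro ⟨t, ⟨h, hs⟩ | ⟨h, hs⟩⟩
    · simpa [h] using hs
    · simpa [h] using hs

theorem def_almostTwoPow (i : α) : DefPred lang fun v : α → YF => AlmostTwoPow (v i) := by
  have h : DefPred lang fun v : α → YF => ∀ w, ¬ (w ≠ [] ∧ one :: w <:+ v i) :=
    .all (.not (def_one_cons_suffix _ _))
  exact h.congr fun v => by simp [AlmostTwoPow]

theorem def_one_pow (i : α) :
    DefPred lang fun v : α → YF => ∃ m, v i = replicate m one ++ [] :=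
  .subst (f := fun _ => []) (Q := fun v x => ∃ m, v i = replicate m one ++ x)
    (def_one_chain _ _) (def_nil _)

theorem def_two_pow (i : α) : DefPred lang fun v : α → YF => ∃ k, v i = replicate k two := by
  have h : DefPred lang fun v : α → YF => AlmostTwoPow (v i) ∧
      ∃ a, (∃ m, a = replicate m one ++ []) ∧ ¬ Precedes a (v i) ∧
        ∀ u', AlmostTwoPow u' → Precedes (v i) u' → v i ≠ u' → Precedes a u' :=
    .and (def_almostTwoPow _) (.ex (.and (def_one_pow _) (.and (.not (def_le _ _))
      (.all (.imp (def_almostTwoPow _) (.imp (def_le _ _) (.imp (.not (.eq _ _)) (def_le _ _))))))))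
  exact h.congr fun v => exists_two_pow_iff

theorem def_two_pow_append_one_cons (i j : α) : DefPred lang fun v : α → YF =>
    v j ≠ [] ∧ ∃ k, v i = replicate k two ++ one :: v j := by
  have h : DefPred lang fun v : α → YF => (v j ≠ [] ∧ one :: v j <:+ v i) ∧
      ∀ t, (t ≠ [] ∧ one :: t <:+ v i) → Precedes t (v j) :=
    .and (def_one_cons_suffix _ _) (.all (.imp (def_one_cons_suffix _ _) (def_le _ _)))
  exact h.congr fun v => by
    rw [exists_two_pow_append_one_cons_iff, and_assoc]
    simp only [and_imp]

theorem def_two_chain (i j : α) :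
    DefPred lang fun v : α → YF => ∃ k, v i = replicate k two ++ v j := by
  have h : DefPred lang fun v : α → YF => Precedes (v j) (v i) ∧
      (((∃ k, v j = replicate k two) ∧ ∃ k, v i = replicate k two) ∨
      ((AlmostTwoPow (v j) ∧ ¬ ∃ k, v j = replicate k two) ∧
        AlmostTwoPow (v i) ∧ ¬ ∃ k, v i = replicate k two) ∨
      ∃ t, (t ≠ [] ∧ ∃ k, v j = replicate k two ++ one :: t) ∧
        (t ≠ [] ∧ ∃ k, v i = replicate k two ++ one :: t)) :=
    .and (def_le _ _) (.or (.and (def_two_pow _) (def_two_pow _))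
      (.or (.and (.and (def_almostTwoPow _) (.not (def_two_pow _)))
        (.and (def_almostTwoPow _) (.not (def_two_pow _))))
        (.ex (.and (def_two_pow_append_one_cons _ _) (def_two_pow_append_one_cons _ _)))))
  refine h.congr fun v => exists_two_pow_append_iff.trans ?_
  refine and_congr_right fun _ => or_congr_right (or_congr_right (exists_congr fun t => ?_))
  tauto

theorem def_suffix (i j : α) : DefPred lang fun v : α → YF => v i <:+ v j := by
  have h : DefPred lang fun v : α → YF => v i = [] ∨
      ∃ u, (∃ k, u = replicate k two ++ v i) ∧ (u = v j ∨ (u ≠ [] ∧ one :: u <:+ v j)) :=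
    .or (def_nil _) (.ex (.and (def_two_chain _ _) (.or (.eq _ _) (def_one_cons_suffix _ _))))
  refine h.congr fun v => suffix_iff_exists.trans ?_
  by_cases hv : v i = []
  · simp [hv]
  · refine or_congr_right (exists_congr fun u => and_congr_right fun ⟨k, hk⟩ => ?_)
    have : u ≠ [] := by simp [hk, hv]
    simp [this]

theorem def_one_cons_suffix' (i j : α) :
    DefPred lang fun v : α → YF => one :: v i <:+ v j :=
  .subst (f := fun v => one :: v i) (Q := fun v x => x <:+ v j) (def_suffix _ _)
    (def_cons_one _ _)

theorem def_d_le (i j : α) : DefPred lang fun v : α → YF => d (v i) ≤ d (v j) := by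
  have h : DefPred lang fun v : α → YF => ∀ u, (∃ k, u = replicate k two) →
      Precedes u (v i) → Precedes u (v j) :=
    .all (.imp (def_two_pow _) (.imp (def_le _ _) (def_le _ _)))
  exact h.congr fun v => d_le_iff

theorem def_d_eq (i j : α) : DefPred lang fun v : α → YF => d (v i) = d (v j) :=
  ((def_d_le i j).and (def_d_le j i)).congr fun _ => le_antisymm_iff

theorem def_one_pow_d (i j : α) :
    DefPred lang fun v : α → YF => v i = replicate (d (v j)) one := by
  have h : DefPred lang fun v : α → YF => (∃ m, v i = replicate m one ++ []) ∧
      ∃ u, (∃ k, u = replicate k two) ∧ d u = d (v j) ∧ Precedes (v i) u ∧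
        ¬ Precedes (one :: v i) u :=
    .and (def_one_pow _) (.ex (.and (def_two_pow _) (.and (def_d_eq _ _) (.and (def_le _ _)
      (.not (def_cons_one_le _ _))))))
  exact h.congr fun v => eq_one_pow_d_iff

theorem def_d_add (i j k : α) :
    DefPred lang fun v : α → YF => d (v i) + d (v j) = d (v k) := by
  have h : DefPred lang fun v : α → YF => ∃ a c u, a = replicate (d (v j)) one ∧
      c = replicate (d (v k)) one ∧ (∃ k, u = replicate k two ++ a) ∧ d u = d (v i) ∧
        Precedes c u ∧ ¬ Precedes (one :: c) u :=
    .ex (.ex (.ex (.and (def_one_pow_d _ _) (.and (def_one_pow_d _ _) (.and (def_two_chain _ _)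
      (.and (def_d_eq _ _) (.and (def_le _ _) (.not (def_cons_one_le _ _)))))))))
  exact h.congr fun v => d_add_eq_iff

theorem def_one_pow_append (i j k : α) :
    DefPred lang fun v : α → YF => v i = replicate (d (v j)) one ++ v k := by
  have h : DefPred lang fun v : α → YF => (∃ m, v i = replicate m one ++ v k) ∧
      ∃ y, (∃ i, y = replicate i two ++ v k) ∧ d (v k) + d (v j) = d y ∧
        Precedes (v i) y ∧ ¬ Precedes (one :: v i) y :=
    .and (def_one_chain _ _) (.ex (.and (def_two_chain _ _) (.and (def_d_add _ _ _)
      (.and (def_le _ _) (.not (def_cons_one_le _ _))))))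
  exact h.congr fun v => eq_one_pow_append_iff

theorem def_e (i j k : α) :
    DefPred lang fun v : α → YF => e (v i) (d (v j)) = d (v k) := by
  have h : DefPred lang fun v : α → YF => (¬ d (v j) ≤ d (v i) ∧ ∃ z, z = [] ∧ d (v k) ≤ d z) ∨
      ∃ u, (¬ ∃ t, u = one :: t) ∧ u <:+ v i ∧ d u + d (v j) = d (v i) ∧
        ∃ r, r = replicate (d (v k)) one ++ u ∧ r <:+ v i ∧ ¬ one :: r <:+ v i :=
    .or (.and (.not (def_d_le _ _)) (.ex (.and (def_nil _) (def_d_le _ _))))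
      (.ex (.and (.not (.ex (def_cons_one _ _))) (.and (def_suffix _ _) (.and (def_d_add _ _ _)
        (.ex (.and (def_one_pow_append _ _ _) (.and (def_suffix _ _)
          (.not (def_one_cons_suffix' _ _)))))))))
  exact h.congr fun v => by rw [e_eq_d_iff]; simp only [exists_eq_left]

theorem def_d_mul (i j k : α) :
    DefPred lang fun v : α → YF => d (v i) * d (v j) = d (v k) := by
  have h : DefPred lang fun v : α → YF => ∃ z t, z = [] ∧ t = [two] ∧ ∃ w, d w = d (v j) ∧
      e w (d z) = d z ∧ (∀ i' j', ¬ d w ≤ d i' → d i' + d t = d j' →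
        ∃ k l, e w (d i') = d k ∧ e w (d j') = d l ∧ d k + d (v i) = d l) ∧
      e w (d (v j)) = d (v k) :=
    .ex (.ex (.and (def_nil _) (.and (def_const_two _) (.ex (.and (def_d_eq _ _)
      (.and (def_e _ _ _) (.and (.all (.all (.imp (.not (def_d_le _ _)) (.imp (def_d_add _ _ _)
        (.ex (.ex (.and (def_e _ _ _) (.and (def_e _ _ _) (def_d_add _ _ _)))))))))
        (def_e _ _ _))))))))
  refine h.congr fun v => d_mul_eq_iff.trans ⟨fun ⟨w, h⟩ => ⟨_, _, rfl, rfl, w, h⟩, ?_⟩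
  rintro ⟨_, _, rfl, rfl, h⟩
  exact h

/-- Arithmetical relations between the numbers of twos are definable in the lattice. -/
theorem def_of_arith {P : (α → ℕ) → Prop} (hP : DefPred Arith.lang P) :
    DefPred lang fun v : α → YF => P fun i => d (v i) := by
  -- The interpretation is many-to-one: numerical equality becomes equality of the numbers of twos.
  refine DefPred.pullback (f := d) (fun n => ⟨replicate n two, by simp⟩) (def_d_eq 0 1)
    (fun n F => ?_) (fun n R => Empty.elim R) hP
  cases F with
  | add => exact (def_d_add (some 0) (some 1) none).congr fun _ => eq_comm
  | mul => exact (def_d_mul (some 0) (some 1) none).congr fun _ => eq_comm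

end Definability

end YF

/-! ### The coding `b` is a bijection -/

namespace YF

open Digit List

theorem factorization_prod_nth_prime (g : ℕ → ℕ) (n j : ℕ) :
    (∏ i ∈ Finset.range n, Nat.nth Nat.Prime i ^ g i).factorization (Nat.nth Nat.Prime j) =
      if j < n then g j else 0 := by
  induction n with
  | zero => simp
  | succ n ih =>
    rw [Finset.prod_range_succ, Nat.factorization_mul
      (Finset.prod_ne_zero_iff.2 fun i _ => pow_ne_zero _ (Nat.prime_nth_prime i).ne_zero)
      (pow_ne_zero _ (Nat.prime_nth_prime n).ne_zero), Finsupp.add_apply, ih,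
      (Nat.prime_nth_prime n).factorization_pow, Finsupp.single_apply]
    have : Nat.nth Nat.Prime n = Nat.nth Nat.Prime j ↔ n = j :=
      (Nat.nth_injective Nat.infinite_setOfPred_prime).eq_iff
    simp only [this]
    rcases lt_trichotomy j n with h | rfl | h
    · simp [h, h.ne', Nat.lt_succ_of_lt h]
    · simp
    · simp [h.ne, h.not_gt, show ¬ j < n + 1 by omega]

theorem b_nil : b [] = 0 := by simp [b]

theorem b_of_d_eq_zero {v : YF} (hv : v ≠ []) (hd : d v = 0) : b v = 2 ^ (v.length - 1) := by
  simp [b, hv, hd]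

/-- The extra 1 in the top exponent makes d(v) the largest index of a prime factor of b(v), so that
it can be recovered even when the last block is empty. -/
theorem b_of_d_ne_zero {v : YF} (hd : d v ≠ 0) : b v = ∏ i ∈ Finset.range (d v + 1),
    Nat.nth Nat.Prime i ^ (e v i + if i = d v then 1 else 0) := by
  have hv : v ≠ [] := by rintro rfl; simp at hd
  rw [Finset.prod_range_succ, mul_comm, b, if_neg hv, if_neg hd, if_pos rfl]
  congr 1
  refine Finset.prod_congr rfl fun i hi => ?_
  rw [if_neg (Finset.mem_range.1 hi).ne, add_zero]

theorem b_ne_zero {v : YF} (hv : v ≠ []) : b v ≠ 0 := by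
  by_cases hd : d v = 0
  · rw [b_of_d_eq_zero hv hd]
    positivity
  · rw [b_of_d_ne_zero hd]
    exact Finset.prod_ne_zero_iff.2 fun i _ => pow_ne_zero _ (Nat.prime_nth_prime i).ne_zero

theorem factorization_b {v : YF} (hd : d v ≠ 0) {j : ℕ} (hj : j ≤ d v) :
    (b v).factorization (Nat.nth Nat.Prime j) = e v j + if j = d v then 1 else 0 := by
  rw [b_of_d_ne_zero hd, factorization_prod_nth_prime, if_pos (by omega)]

theorem factorization_b_of_lt {v : YF} {j : ℕ} (hj : d v < j) :
    (b v).factorization (Nat.nth Nat.Prime j) = 0 := by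
  by_cases hv : v = []
  · simp [hv, b_nil]
  by_cases hd : d v = 0
  · rw [b_of_d_eq_zero hv hd, Nat.prime_two.factorization_pow, Finsupp.single_apply, if_neg]
    rw [← Nat.nth_prime_zero_eq_two, (Nat.nth_injective Nat.infinite_setOfPred_prime).eq_iff]
    omega
  · rw [b_of_d_ne_zero hd, factorization_prod_nth_prime, if_neg (by omega)]

theorem b_injective : Function.Injective b := by
  have hle : ∀ {v w}, b v = b w → d w ≤ d v := by
    intro v w h
    by_contra hlt
    have h₁ := factorization_b_of_lt (v := v) (j := d w) (by omega)
    rw [h, factorization_b (by omega) le_rfl] at h₁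
    simp at h₁
  intro v w h
  have hd := le_antisymm (hle h.symm) (hle h)
  by_cases hv : v = []
  · by_contra hw
    exact b_ne_zero (v := w) (fun e => hw (hv.trans e.symm)) (by rw [← h, hv, b_nil])
  by_cases hw : w = []
  · exact absurd (by rw [h, hw, b_nil]) (b_ne_zero hv)
  by_cases h0 : d v = 0
  · rw [b_of_d_eq_zero hv h0, b_of_d_eq_zero hw (hd ▸ h0)] at h
    have h := Nat.pow_right_injective le_rfl h
    have := length_pos_iff.2 hv
    have := length_pos_iff.2 hw
    have hl : v.length = w.length := by omega
    rw [length_eq, length_eq, hd] at hl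
    rw [eq_replicate_one h0, eq_replicate_one (hd ▸ h0 : d w = 0), Nat.add_left_cancel hl]
  · refine eq_of_e_eq hd fun i hi => ?_
    have := factorization_b h0 hi
    rw [h, factorization_b (hd ▸ h0) (hd ▸ hi), hd] at this
    exact (Nat.add_right_cancel this).symm

theorem b_surjective : Function.Surjective b := by
  intro n
  by_cases hn : n = 0
  · exact ⟨[], hn ▸ b_nil⟩
  have hmono := Nat.nth_strictMono Nat.infinite_setOfPred_prime
  -- The largest index of a prime factor; n bounds the search as i ≤ p_i. The default 0 covers n =
  -- 1, so D = 0 exactly for powers of 2.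
  let D := Nat.findGreatest (fun i => Nat.nth Nat.Prime i ∣ n) n
  have hD : ∀ j, D < j → n.factorization (Nat.nth Nat.Prime j) = 0 := fun j hj =>
    Nat.factorization_eq_zero_of_not_dvd fun hdvd =>
      absurd (Nat.le_findGreatest (P := fun i => Nat.nth Nat.Prime i ∣ n)
        ((hmono.le_apply).trans (Nat.le_of_dvd (Nat.pos_of_ne_zero hn) hdvd)) hdvd) hj.not_ge
  have hext : ∀ m, m ≠ 0 → (∀ j, m.factorization (Nat.nth Nat.Prime j) =
      n.factorization (Nat.nth Nat.Prime j)) → m = n := fun m hm h =>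
    Nat.eq_of_factorization_eq hm hn fun q => by
      by_cases hq : q.Prime
      · rw [← Nat.nth_count hq, h]
      · rw [Nat.factorization_eq_zero_of_not_prime _ hq, Nat.factorization_eq_zero_of_not_prime _ hq]
  by_cases h0 : D = 0
  · refine ⟨replicate (n.factorization 2 + 1) one, hext _ (b_ne_zero (by simp)) fun j => ?_⟩
    rw [b_of_d_eq_zero (by simp) (by simp), Nat.prime_two.factorization_pow, Finsupp.single_apply]
    rcases Nat.eq_zero_or_pos j with rfl | hj
    · simp [Nat.nth_prime_zero_eq_two]
    · rw [if_neg, hD j (h0 ▸ hj)]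
      rw [← Nat.nth_prime_zero_eq_two, (Nat.nth_injective Nat.infinite_setOfPred_prime).eq_iff]
      omega
  · have hdvd : Nat.nth Nat.Prime D ∣ n :=
      Nat.findGreatest_of_ne_zero (P := fun i => Nat.nth Nat.Prime i ∣ n) rfl h0
    have hpos := (Nat.prime_nth_prime D).factorization_pos_of_dvd hn hdvd
    obtain ⟨v, hv, he⟩ := exists_word D fun i =>
      n.factorization (Nat.nth Nat.Prime i) - if i = D then 1 else 0
    have hd : d v ≠ 0 := hv ▸ h0
    refine ⟨v, hext _ (b_ne_zero (by rintro rfl; simp at hd)) fun j => ?_⟩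
    rcases le_or_gt j D with hj | hj
    · rw [factorization_b hd (hv ▸ hj), he j hj, hv]
      split_ifs with h
      · subst h; omega
      · rfl
    · rw [factorization_b_of_lt (hv ▸ hj), hD j hj]

end YF

/-! ### Powers, products and the n-th prime in arithmetic -/

section ArithmeticFunctions

variable {α : Type*} {f g : (α → ℕ) → ℕ}

theorem DefFn.rec_comp {g : (α → ℕ) → ℕ → ℕ → ℕ} {k : (α → ℕ) → ℕ} (hf : DefFn f)
    (hg : DefFn fun v : Option (Option α) → ℕ =>
      g (fun i => v (some (some i))) (v (some none)) (v none)) (hk : DefFn k) :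
    DefFn fun v => Nat.rec (f v) (g v) (k v) :=
  DefPred.subst (L := Arith.lang) (f := fun v : Option α → ℕ => k fun i => v (some i))
    (Q := fun v x => v none = Nat.rec (f fun i => v (some i)) (g fun i => v (some i)) x)
    (DefPred.rename (DefFn.natRec hf hg)
      fun i => i.elim (some none) fun i => i.elim none fun i => some (some i))
    (hk.rename some)

theorem DefFn.pow (hf : DefFn f) (hg : DefFn g) : DefFn fun v => f v ^ g v :=
  (DefFn.rec_comp (f := fun _ => 1) (g := fun v _ r => r * f v) (.const 1)
    ((DefFn.var _).mul (hf.rename fun i => some (some i))) hg).congr fun v => by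
      induction g v with
      | zero => rfl
      | succ n ih => rw [pow_succ, ih]

theorem DefFn.prod_range {g : (α → ℕ) → ℕ → ℕ} {k : (α → ℕ) → ℕ}
    (hg : DefFn fun v : Option α → ℕ => g (fun i => v (some i)) (v none)) (hk : DefFn k) :
    DefFn fun v => ∏ i ∈ Finset.range (k v), g v i :=
  (DefFn.rec_comp (f := fun _ => 1) (g := fun v i r => r * g v i) (.const 1)
    ((DefFn.var _).mul (hg.rename fun i => i.elim (some none) fun i => some (some i)))
    hk).congr fun v => by
      induction k v with
      | zero => rfl
      | succ n ih => rw [Finset.prod_range_succ, ih]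

theorem DefFn.prime (hf : DefFn f) : DefPred Arith.lang fun v => (f v).Prime := by
  have h : DefPred Arith.lang fun v : α → ℕ => 1 < f v ∧ ∀ m, (∃ c, f v = m * c) → m = 1 ∨ m = f v :=
    .and (DefFn.lt (.const 1) hf) (.all (.imp
      (.ex (DefFn.eq (hf.rename fun i => some (some i)) (.mul (.var _) (.var _))))
      (.or (DefFn.eq (.var _) (.const 1)) (DefFn.eq (.var _) (hf.rename some)))))
  exact h.congr fun v => by rw [Nat.prime_def]; rfl

theorem DefFn.nth_prime (hf : DefFn f) : DefFn fun v => Nat.nth Nat.Prime (f v) := by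
  have hcount : DefFn fun v : Fin 1 → ℕ => Nat.count Nat.Prime (v 0) :=
    (DefFn.rec_comp (f := fun _ => 0) (g := fun _ i r => r + if i.Prime then 1 else 0) (.const 0)
      ((DefFn.var _).add (.ite (DefFn.prime (.var _)) (.const 1) (.const 0))) (.var 0)).congr
        fun v => by
          induction v 0 with
          | zero => simp
          | succ n ih => rw [Nat.count_succ, ih]
  -- The n-th prime is the prime with exactly n primes below it, and counting is a recursion.
  have h : DefPred Arith.lang fun v : Option (Fin 1) → ℕ =>
      (v none).Prime ∧ Nat.count Nat.Prime (v none) = v (some 0) :=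
    .and (DefFn.prime (.var _)) (DefFn.eq (hcount.comp₁ (.var _)) (.var _))
  refine DefFn.comp₁ (F := fun x => Nat.nth Nat.Prime x) (h.congr fun v => ?_) hf
  change v none = Nat.nth Nat.Prime (v (some 0)) ↔ _
  constructor
  · intro h
    rw [h]
    exact ⟨Nat.prime_nth_prime _, Nat.count_nth_of_infinite Nat.infinite_setOfPred_prime _⟩
  · rintro ⟨h₁, h₂⟩
    rw [← h₂, Nat.nth_count h₁]

end ArithmeticFunctions

/-! ### Words in arithmetic through standard Gödel codes -/

namespace YF

open Digit List

/-- The two digits as Booleans. -/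
def digitEquiv : Digit ≃ Bool where
  toFun a := a = two
  invFun a := if a then two else one
  left_inv a := by cases a <;> rfl
  right_inv a := by cases a <;> rfl

instance : Primcodable Digit := .ofEquiv Bool digitEquiv

/-- The word with a given code in the standard encoding. -/
def dec (n : ℕ) : YF := (Encodable.decode n).getD []

theorem dec_encode (v : YF) : dec (Encodable.encode v) = v := by simp [dec]

theorem primrec_dec : Primrec dec :=
  Primrec.option_getD.comp Primrec.decode (Primrec.const [])

theorem primrec_d : Primrec d :=
  (Primrec.list_foldr (f := fun v : YF => v) (g := fun _ => 0)
    (h := fun _ p => p.2 + if p.1 = two then 1 else 0) Primrec.id (Primrec.const 0)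
    (Primrec.nat_add.comp (Primrec.snd.comp Primrec.snd)
      (Primrec.ite (Primrec.eq.comp (Primrec.fst.comp Primrec.snd) (Primrec.const two))
        (Primrec.const 1) (Primrec.const 0)))).of_eq fun v => by
    induction v with
    | nil => rfl
    | cons a v ih => cases a <;> simp_all

theorem primrec_o : Primrec o :=
  (Primrec.nat_sub.comp Primrec.list_length primrec_d).of_eq fun v => by
    rw [length_eq]; simp

/-- The lengths of the blocks of ones of a word. -/
def blocks (v : YF) : List ℕ :=
  v.foldr (fun a l => if a = one then (l.headI + 1) :: l.tail else 0 :: l) [0]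

theorem blocks_ne_nil (v : YF) : blocks v ≠ [] := by
  cases v with
  | nil => simp [blocks]
  | cons a v => cases a <;> simp [blocks]

theorem e_eq_getD_blocks (v : YF) (i : ℕ) : e v i = (blocks v).getD i 0 := by
  induction v generalizing i with
  | nil => cases i <;> simp [e, blocks]
  | cons a v ih =>
    cases a
    · have h : blocks (one :: v) = ((blocks v).headI + 1) :: (blocks v).tail := by simp [blocks]
      rw [h]
      obtain ⟨k, l, hl⟩ := exists_cons_of_ne_nil (blocks_ne_nil v)
      cases i <;> simp [e, ih, hl]
    · have h : blocks (two :: v) = 0 :: blocks v := by simp [blocks]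
      rw [h]
      cases i <;> simp [e, ih]

theorem primrec_blocks : Primrec blocks :=
  Primrec.list_foldr (f := fun v : YF => v) (g := fun _ => [0])
    (h := fun _ p => if p.1 = one then (p.2.headI + 1) :: p.2.tail else 0 :: p.2)
    Primrec.id (Primrec.const [0])
    (Primrec.ite (Primrec.eq.comp (Primrec.fst.comp Primrec.snd) (Primrec.const one))
      (Primrec.list_cons.comp (Primrec.succ.comp
        (Primrec.list_headI.comp (Primrec.snd.comp Primrec.snd)))
        (Primrec.list_tail.comp (Primrec.snd.comp Primrec.snd)))
      (Primrec.list_cons.comp (Primrec.const 0) (Primrec.snd.comp Primrec.snd)))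

theorem primrec_e : Primrec₂ e :=
  ((Primrec.list_getD 0).comp (primrec_blocks.comp Primrec.fst) Primrec.snd).of_eq
    fun p => (e_eq_getD_blocks p.1 p.2).symm

section

variable {α : Type*} {f g : (α → ℕ) → ℕ}

theorem defFn_d_dec (hf : DefFn f) : DefFn fun v => d (dec (f v)) :=
  Primrec.defFn (F := fun n => d (dec n)) (primrec_d.comp primrec_dec) hf

theorem defFn_o_dec (hf : DefFn f) : DefFn fun v => o (dec (f v)) :=
  Primrec.defFn (F := fun n => o (dec n)) (primrec_o.comp primrec_dec) hf

theorem defFn_length_dec (hf : DefFn f) : DefFn fun v => (dec (f v)).length :=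
  Primrec.defFn (F := fun n => (dec n).length) (Primrec.list_length.comp primrec_dec) hf

theorem defFn_e_dec (hf : DefFn f) (hg : DefFn g) : DefFn fun v => e (dec (f v)) (g v) :=
  Primrec₂.defFn (F := fun n i => e (dec n) i)
    (primrec_e.comp (primrec_dec.comp Primrec.fst) Primrec.snd) hf hg

theorem defFn_b_dec (hf : DefFn f) : DefFn fun v => b (dec (f v)) := by
  have hd := defFn_d_dec hf
  have hl := defFn_length_dec hf
  have h : DefFn fun v => if (dec (f v)).length = 0 then 0 else
      if d (dec (f v)) = 0 then 2 ^ ((dec (f v)).length - 1) else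
      Nat.nth Nat.Prime (d (dec (f v))) ^ (e (dec (f v)) (d (dec (f v))) + 1) *
        ∏ i ∈ Finset.range (d (dec (f v))), Nat.nth Nat.Prime i ^ e (dec (f v)) i :=
    .ite (hl.eq (.const 0)) (.const 0) (.ite (hd.eq (.const 0))
      (.pow (.const 2) (Primrec₂.defFn Primrec.nat_sub hl (.const 1)))
      (.mul (.pow hd.nth_prime (.add (defFn_e_dec hf hd) (.const 1)))
        (.prod_range (.pow (DefFn.nth_prime (.var _)) (defFn_e_dec (hf.rename some) (.var _))) hd)))
  exact h.congr fun v => by simp only [b, length_eq_zero_iff]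

theorem def_precedes_dec (hf : DefFn f) (hg : DefFn g) :
    DefPred Arith.lang fun v => Precedes (dec (f v)) (dec (g v)) := by
  have hsuf : DefPred Arith.lang fun v : Fin 2 → ℕ => dec (v 0) <:+ dec (v 1) := by
    -- Equality of words is tested on the codes of the decoded words, which does not require `dec`
    -- to be injective.
    have h : DefPred Arith.lang fun v : Fin 2 → ℕ => ∃ p,
        Encodable.encode (dec p ++ dec (v 0)) = Encodable.encode (dec (v 1)) :=
      .ex (DefFn.eq
        (Primrec₂.defFn (F := fun m n => Encodable.encode (dec m ++ dec n))
          (Primrec.encode.comp (Primrec.list_append.comp (primrec_dec.comp Primrec.fst)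
            (primrec_dec.comp Primrec.snd))) (.var _) (.var _))
        (Primrec.defFn (F := fun m => Encodable.encode (dec m))
          (Primrec.encode.comp primrec_dec) (.var _)))
    refine h.congr fun v => ?_
    simp only [Encodable.encode_inj]
    exact ⟨fun ⟨p, hp⟩ => ⟨Encodable.encode p, by rw [dec_encode, hp]⟩, fun ⟨p, hp⟩ => ⟨_, hp⟩⟩
  have h : DefPred Arith.lang fun v : α → ℕ => ∃ c, dec c <:+ dec (f v) ∧ dec c <:+ dec (g v) ∧
      (dec (f v)).length < d (dec (g v)) + o (dec c) + 1 :=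
    .ex (.and (DefPred.comp₂ (R := fun x y => dec x <:+ dec y) hsuf (.var _) (hf.rename some))
      (.and (DefPred.comp₂ (R := fun x y => dec x <:+ dec y) hsuf (.var _) (hg.rename some))
      (DefFn.lt (defFn_length_dec (hf.rename some))
        (.add (.add (defFn_d_dec (hg.rename some)) (defFn_o_dec (.var _))) (.const 1)))))
  refine h.congr fun v => precedes_iff.trans ?_
  simp only [Nat.lt_succ_iff]
  exact ⟨fun ⟨c, hc⟩ => ⟨Encodable.encode c, by rwa [dec_encode]⟩, fun ⟨c, hc⟩ => ⟨_, hc⟩⟩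

end

end YF

/-! ### Transfer in both directions -/

namespace YF

open Digit List

theorem b_bijective : Function.Bijective b := ⟨b_injective, b_surjective⟩

/-- The word with a given code under `b`. -/
noncomputable def bInv : ℕ → YF := Function.surjInv b_surjective

theorem b_bInv (n : ℕ) : b (bInv n) = n := Function.surjInv_eq b_surjective n

theorem bInv_b (v : YF) : bInv (b v) = v := b_injective (b_bInv _)

theorem bInv_surjective : Function.Surjective bInv := fun v => ⟨b v, bInv_b v⟩

theorem bInv_injective : Function.Injective bInv := fun m n h => by rw [← b_bInv m, h, b_bInv]

section

variable {α : Type*}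

/-- This passes from codes under `b` to Gödel codes: the inverse of `b` is replaced by a search for
a Gödel code s. -/
theorem exists_b_dec (n : ℕ) (P : YF → Prop) : P (bInv n) ↔ ∃ s, n = b (dec s) ∧ P (dec s) :=
  ⟨fun h => ⟨Encodable.encode (bInv n), by rwa [dec_encode, b_bInv, and_iff_right rfl]⟩,
    fun ⟨s, hs, h⟩ => by rwa [hs, bInv_b]⟩

theorem def_d_bInv (i j : α) :
    DefPred Arith.lang fun v : α → ℕ => d (bInv (v i)) = v j := by
  have h : DefPred Arith.lang fun v : α → ℕ => ∃ s, v i = b (dec s) ∧ d (dec s) = v j :=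
    .ex (.and (DefFn.eq (.var _) (defFn_b_dec (.var _)))
      (DefFn.eq (defFn_d_dec (.var _)) (.var _)))
  exact h.congr fun v => exists_b_dec (v i) fun w => d w = v j

theorem def_e_bInv (i j k : α) :
    DefPred Arith.lang fun v : α → ℕ => e (bInv (v i)) (v j) = v k := by
  have h : DefPred Arith.lang fun v : α → ℕ => ∃ s, v i = b (dec s) ∧ e (dec s) (v j) = v k :=
    .ex (.and (DefFn.eq (.var _) (defFn_b_dec (.var _)))
      (DefFn.eq (defFn_e_dec (.var _) (.var _)) (.var _)))
  exact h.congr fun v => exists_b_dec (v i) fun w => e w (v j) = v k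

theorem def_precedes_bInv (i j : α) :
    DefPred Arith.lang fun v : α → ℕ => Precedes (bInv (v i)) (bInv (v j)) := by
  have h : DefPred Arith.lang fun v : α → ℕ => ∃ s, v i = b (dec s) ∧
      ∃ t, v j = b (dec t) ∧ Precedes (dec s) (dec t) :=
    .ex (.and (DefFn.eq (.var _) (defFn_b_dec (.var _)))
      (.ex (.and (DefFn.eq (.var _) (defFn_b_dec (.var _))) (def_precedes_dec (.var _) (.var _)))))
  refine h.congr fun v => (exists_b_dec (v i) fun w => Precedes w (bInv (v j))).trans ?_
  exact exists_congr fun s => and_congr_right fun _ =>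
    exists_b_dec (v j) fun w => Precedes (dec s) w

theorem arith_of_def {P : (α → YF) → Prop} (hP : DefPred lang P) :
    DefPred Arith.lang fun v : α → ℕ => P fun i => bInv (v i) := by
  refine DefPred.pullback (f := bInv) bInv_surjective
    ((DefPred.eq 0 1).congr fun v => bInv_injective.eq_iff) (fun n F => ?_) (fun n R => ?_) hP
  · cases F
    refine (DefFn.eq (.var none) (.const (b [two]))).congr fun v => ?_
    change bInv (v none) = [two] ↔ _
    exact ⟨fun h => by rw [← h, b_bInv], fun h => by rw [h, bInv_b]⟩
  · cases R
    exact (def_precedes_bInv 1 0).congr fun v => Iff.rfl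

/-- The code of a word is definable in the lattice, a number being represented by a word with that
many twos. -/
theorem def_b_eq_d (i j : α) : DefPred lang fun v : α → YF => b (v i) = d (v j) := by
  have hd := def_of_arith (α := α) (def_d_bInv j i)
  have he := fun {γ : Type _} (i j k : γ) => def_of_arith (def_e_bInv i j k)
  have h : DefPred lang fun v : α → YF => d (bInv (d (v j))) = d (v i) ∧
      ∀ i' k, e (v i) (d i') = d k → e (bInv (d (v j))) (d i') = d k :=
    .and hd (.all (.all (.imp (def_e _ _ _) (he _ _ _))))
  refine h.congr fun v => ⟨fun h => ?_, fun ⟨h₁, h₂⟩ => ?_⟩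
  · rw [← h, bInv_b]
    exact ⟨rfl, fun _ _ => id⟩
  · have : bInv (d (v j)) = v i := eq_of_e_eq h₁ fun n _ => by
      simpa using h₂ (replicate n two) (replicate (e (v i) n) two) (by simp)
    rw [← this, b_bInv]

theorem def_of_arith_b {P : (α → ℕ) → Prop} (hP : DefPred Arith.lang P) :
    DefPred lang fun v : α → YF => P fun i => b (v i) := by
  have hop : ∀ {op : ℕ → ℕ → ℕ},
      (∀ {γ : Type} (i j k : γ), DefPred lang fun v : γ → YF => op (d (v i)) (d (v j)) = d (v k)) →
      DefPred lang fun v : Option (Fin 2) → YF =>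
        b (v none) = op (b (v (some 0))) (b (v (some 1))) := by
    intro op h
    -- The codes are replaced by words with as many twos, where the operation is already definable.
    have h' : DefPred lang fun v : Option (Fin 2) → YF => ∃ x y z, b (v (some 0)) = d x ∧
        b (v (some 1)) = d y ∧ b (v none) = d z ∧ op (d x) (d y) = d z :=
      .ex (.ex (.ex (.and (def_b_eq_d _ _) (.and (def_b_eq_d _ _) (.and (def_b_eq_d _ _)
        (h _ _ _))))))
    refine h'.congr fun v => ⟨fun h => ?_, fun ⟨x, y, z, hx, hy, hz, h⟩ => by rw [hx, hy, hz, h]⟩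
    exact ⟨replicate _ two, replicate _ two, replicate _ two, (d_replicate_two _).symm,
      (d_replicate_two _).symm, (d_replicate_two _).symm, by simp [h]⟩
  refine DefPred.pullback (f := b) b_surjective ((DefPred.eq 0 1).congr fun v => b_injective.eq_iff)
    (fun n F => ?_) (fun n R => Empty.elim R) hP
  cases F with
  | add => exact hop (op := fun x y => x + y) def_d_add
  | mul => exact hop (op := fun x y => x * y) def_d_mul

end

end YF

theorem mainTheorem3 :
    Function.Bijective YF.b ∧
      ∀ (k : ℕ) (R : Set (Fin k → YF)),
        (∅ : Set YF).Definable YF.lang R ↔ YF.Arithmetical R := by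
  refine ⟨YF.b_bijective, fun k R => ⟨fun h => ?_, fun h => ?_⟩⟩
  · have := YF.arith_of_def (P := fun v => v ∈ R) h
    refine this.congr fun v => ?_
    constructor
    · rintro ⟨w, hw, rfl⟩
      simpa [YF.bInv_b] using hw
    · exact fun hv => ⟨_, hv, by simp [YF.b_bInv]⟩
  · have := YF.def_of_arith_b
      (P := fun v => v ∈ (fun (v : Fin k → YF) (i : Fin k) => YF.b (v i)) '' R) h
    refine this.congr fun v => ⟨fun hv => ⟨v, hv, rfl⟩, ?_⟩
    rintro ⟨w, hw, h⟩
    have : w = v := funext fun i => YF.b_injective (congrFun h i)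
    exact this ▸ hw
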